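/- Let $\Gamma$ be a torsionless commutative cancellative monoid (written additively), $R=\bigoplus_{\alpha\in\Gamma}R_\alpha$ a $\Gamma$-graded integral domain with quotient field $K$, $H$ the set of its nonzero homogeneous elements and $R_H\subseteq K$ its homogeneous quotient field. Let $\mathbf F(R)$ be the set of nonzero fractional ideals of $R$, and $\mathbf{HF}(R)$ the subset of the homogeneous ones, i.e. of those $A$ such that $tA$ is a homogeneous ideal of $R$ for some $t\in H$. For $f\in R_H$ let $\mathbf C(f)$ be the fractional ideal generated by the homogeneous components of $f$, and for $A\in\mathbf F(R)$ with $A\subseteq R_H$ let $\mathbf C(A)=\sum_{f\in A}\mathbf C(f)$. A star operation on $R$ is a map $\star:\mathbf F(R)\to\mathbf F(R)$, $A\mapsto A^\star$, such that for all $0\neq x\in K$ and $A,B\in\mathbf F(R)$: $(xR)^\star=xR$ and $(xA)^\star=xA^\star$; $A\subseteq A^\star$, and $A\subseteq B$ implies $A^\star\subseteq B^\star$; $(A^\star)^\star=A^\star$. A homogeneous star operation is a map $\star:\mathbf{HF}(R)\to\mathbf{HF}(R)$ with the same properties for all nonzero homogeneous $x\in R_H$ and all $A,B\in\mathbf{HF}(R)$.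 A star operation $\bigstar$ extends a homogeneous star operation $\star$ if $A^\bigstar=A^\star$ for all $A\in\mathbf{HF}(R)$. For star operations, $\star_1\le\star_2$ means $A^{\star_1}\subseteq A^{\star_2}$ for all $A\in\mathbf F(R)$, and "largest" refers to this order. For a star operation $\star$ and $A\in\mathbf F(R)$ put $$A^{\star_f}=\bigcup\{B^\star\mid B\in\mathbf F(R)\text{ finitely generated},\ B\subseteq A\},$$ $$A^{\widetilde\star}=\{x\in K\mid xJ\subseteq A\text{ for some nonzero finitely generated ideal }J\text{ of }R\text{ with }J^\star=R\},$$ $$A^{\overline\star}=\bigcup\{(A:I)\mid I\text{ a nonzero ideal of }R\text{ with }I^\star=R\}.$$ For a homogeneous star operation $\star$ and $A\in\mathbf{HF}(R)$, define $A^{\star_f}$, $A^{\widetilde\star}$ and $A^{\overline\star}$ by the same formulas, with $B$, $J$ and $I$ required to be homogeneous and $x\in R_H$ in the second. A star operation $\star$ is of finite type if $\star=\star_f$, and stable if $(A\cap B)^\star=A^\star\cap B^\star$ for all $A,B\in\mathbf F(R)$. For a homogeneous star operation $\star$ and $A\in\mathbf F(R)$ put $$A^{\mathfrak e(\star)}=\bigcap\{z^{-1}(\mathbf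 C(zA))^\star\mid 0\neq z\in(R:A)\}.$$ Theorem. Let $\star$ be a homogeneous star operation on $R$. Then $\star_f$, $\widetilde\star$ and $\overline\star$ are homogeneous star operations, and: 1. $(\mathfrak e(\star))_f=(\mathfrak e(\star_f))_f$, and this is the largest finite type star operation on $R$ that extends $\star_f$. 2. $\widetilde{\mathfrak e(\star)}=\widetilde{\mathfrak e(\widetilde\star)}$, and this is the largest stable star operation of finite type on $R$ that extends $\widetilde\star$. 3. $\overline{\mathfrak e(\star)}=\overline{\mathfrak e(\overline\star)}$, and this is the largest stable star operation on $R$ that extends $\overline\star$. -/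

import Mathlib

open scoped Pointwise nonZeroDivisors

set_option linter.unusedSectionVars false

namespace GradedStar

/-! ### Fractional ideals and star operations -/

section Classical

variable (R K : Type*) [CommRing R] [IsDomain R] [Field K] [Algebra R K] [IsFractionRing R K]

/-- `F R K` is the set of nonzero fractional ideals of the domain `R` with quotient field `K`. -/
def F : Set (Submodule R K) := {A | A ≠ ⊥ ∧ IsFractional R⁰ A}

variable {R K}

/-- The map `s` (only its values on `F R K` matter) is a (classical) star operation.
The fractional ideal `R` is `1`, and `(x) = xR` is `x • 1`. -/
structure IsStar (s : Submodule R K → Submodule R K) : Prop where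
  mem : ∀ A ∈ F R K, s A ∈ F R K
  principal : ∀ x : K, x ≠ 0 → s (x • 1) = x • 1
  smul : ∀ x : K, x ≠ 0 → ∀ A ∈ F R K, s (x • A) = x • s A
  le : ∀ A ∈ F R K, A ≤ s A
  mono : ∀ A ∈ F R K, ∀ B ∈ F R K, A ≤ B → s A ≤ s B
  idem : ∀ A ∈ F R K, s (s A) = s A

/-- The star operation of finite type associated to `s`: `A` goes to the union of the `s B`,
for the nonzero finitely generated fractional ideals `B ⊆ A`. The span only serves to have a
submodule by definition: see `coe_finiteType`. -/
def finiteType (s : Submodule R K → Submodule R K) (A : Submodule R K) : Submodule R K :=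
  Submodule.span R {x | ∃ B ∈ F R K, B.FG ∧ B ≤ A ∧ x ∈ s B}

/-- The stable star operation of finite type associated to `s`: `A` goes to the set of the `x ∈ K`
with `xJ ⊆ A` for some nonzero finitely generated ideal `J` of `R` with `s J = R`. The span only
serves to have a submodule by definition: see `coe_tilde`. -/
def tilde (s : Submodule R K → Submodule R K) (A : Submodule R K) : Submodule R K :=
  Submodule.span R {x | ∃ J ∈ F R K, J.FG ∧ J ≤ 1 ∧ s J = 1 ∧ x • J ≤ A}

/-- The stable star operation associated to `s`: `A` goes to the union of the `(A : I)`,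
for the nonzero ideals `I` of `R` with `s I = R`. The span only serves to have a submodule by
definition: see `coe_bar`. -/
def bar (s : Submodule R K → Submodule R K) (A : Submodule R K) : Submodule R K :=
  Submodule.span R {x | ∃ I ∈ F R K, I ≤ 1 ∧ s I = 1 ∧ x ∈ A / I}

/-- `s` is of finite type. -/
def IsFiniteType (s : Submodule R K → Submodule R K) : Prop :=
  Set.EqOn s (finiteType s) (F R K)

/-- `s` is stable. -/
def IsStable (s : Submodule R K → Submodule R K) : Prop :=
  ∀ A ∈ F R K, ∀ B ∈ F R K, s (A ⊓ B) = s A ⊓ s B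

/-! The sets that are spanned in the last three definitions are submodules already. -/

theorem one_mem_F : (1 : Submodule R K) ∈ F R K :=
  ⟨one_ne_zero, 1, one_mem _, by
    intro b hb
    obtain ⟨y, rfl⟩ := Submodule.mem_one.1 hb
    exact ⟨y, by simp⟩⟩

theorem isFractional_mono {A B : Submodule R K} (hA : IsFractional R⁰ A) (h : B ≤ A) :
    IsFractional R⁰ B := by
  obtain ⟨a, ha, haA⟩ := hA
  exact ⟨a, ha, fun b hb => haA b (h hb)⟩

theorem mul_mem_F {A B : Submodule R K} (hA : A ∈ F R K) (hB : B ∈ F R K) : A * B ∈ F R K := by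
  refine ⟨?_, hA.2.mul hB.2⟩
  obtain ⟨a, ha, ha0⟩ := (Submodule.ne_bot_iff A).1 hA.1
  obtain ⟨b, hb, hb0⟩ := (Submodule.ne_bot_iff B).1 hB.1
  exact (Submodule.ne_bot_iff _).2 ⟨a * b, Submodule.mul_mem_mul ha hb, mul_ne_zero ha0 hb0⟩

theorem sup_mem_F {A B : Submodule R K} (hA : A ∈ F R K) (hB : B ∈ F R K) : A ⊔ B ∈ F R K :=
  ⟨fun h => hA.1 (le_bot_iff.1 (h ▸ le_sup_left)), hA.2.sup hB.2⟩

theorem IsStar.mul_eq_one {s : Submodule R K → Submodule R K} (hs : IsStar s)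
    {I J : Submodule R K} (hI : I ∈ F R K) (hJ : J ∈ F R K) (hI1 : I ≤ 1) (hJ1 : J ≤ 1)
    (hsI : s I = 1) (hsJ : s J = 1) : s (I * J) = 1 := by
  have h1 : s 1 = 1 := by simpa using hs.principal 1 one_ne_zero
  have hIJ := mul_mem_F hI hJ
  apply le_antisymm
  · rw [← h1]
    exact hs.mono _ hIJ _ one_mem_F ((mul_le_mul' hI1 hJ1).trans (by simp))
  · have hle : I ≤ s (I * J) := by
      intro x hx
      rcases eq_or_ne x 0 with rfl | hx0
      · exact zero_mem _
      have hxF : x • J ∈ F R K := by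
        obtain ⟨b, hb, hb0⟩ := (Submodule.ne_bot_iff J).1 hJ.1
        refine ⟨(Submodule.ne_bot_iff _).2 ⟨x * b, Submodule.smul_mem_pointwise_smul b x J hb,
          mul_ne_zero hx0 hb0⟩, isFractional_mono hJ.2 ?_⟩
        intro y hy
        obtain ⟨z, hz, rfl⟩ := Submodule.mem_smul_pointwise_iff_exists y x _ |>.1 hy
        simpa using Submodule.mul_mem_mul (hI1 hx) hz
      have hxJ : x • J ≤ I * J := by
        intro y hy
        obtain ⟨z, hz, rfl⟩ := Submodule.mem_smul_pointwise_iff_exists y x _ |>.1 hy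
        exact Submodule.mul_mem_mul hx hz
      have h2 := hs.mono _ hxF _ hIJ hxJ
      rw [hs.smul x hx0 J hJ, hsJ] at h2
      apply h2
      simpa using Submodule.smul_mem_pointwise_smul (1 : K) x _ (Submodule.one_le.1 le_rfl)
    calc (1 : Submodule R K) = s I := hsI.symm
      _ ≤ s (s (I * J)) := hs.mono _ hI _ (hs.mem _ hIJ) hle
      _ = s (I * J) := hs.idem _ hIJ

theorem coe_span_eq {S : Set K} (h0 : S.Nonempty)
    (hadd : ∀ x ∈ S, ∀ y ∈ S, x + y ∈ S) (hsmul : ∀ r : R, ∀ x ∈ S, r • x ∈ S) :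
    (Submodule.span R S : Set K) = S := by
  obtain ⟨x, hx⟩ := h0
  let N : Submodule R K :=
    { carrier := S
      add_mem' := fun ha hb => hadd _ ha _ hb
      zero_mem' := by simpa using hsmul 0 x hx
      smul_mem' := fun r y hy => hsmul r y hy }
  exact congrArg SetLike.coe (Submodule.span_eq N)

theorem coe_finiteType {s : Submodule R K → Submodule R K} (hs : IsStar s)
    {A : Submodule R K} (hA : A ∈ F R K) :
    (finiteType s A : Set K) = {x | ∃ B ∈ F R K, B.FG ∧ B ≤ A ∧ x ∈ s B} := by
  apply coe_span_eq
  · obtain ⟨a, ha, ha0⟩ := (Submodule.ne_bot_iff A).1 hA.1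
    have hle : Submodule.span R {a} ≤ A := by simpa using ha
    exact ⟨0, Submodule.span R {a}, ⟨by simpa using ha0, isFractional_mono hA.2 hle⟩,
      Submodule.fg_span_singleton a, hle, zero_mem _⟩
  · rintro x ⟨B, hB, hBf, hBA, hx⟩ y ⟨C, hC, hCf, hCA, hy⟩
    have hBC := sup_mem_F hB hC
    exact ⟨B ⊔ C, hBC, hBf.sup hCf, sup_le hBA hCA,
      add_mem (hs.mono _ hB _ hBC le_sup_left hx) (hs.mono _ hC _ hBC le_sup_right hy)⟩
  · rintro r x ⟨B, hB, hBf, hBA, hx⟩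
    exact ⟨B, hB, hBf, hBA, Submodule.smul_mem _ r hx⟩

theorem smul_le_iff {x : K} {J A : Submodule R K} : x • J ≤ A ↔ ∀ y ∈ J, x * y ∈ A := by
  constructor
  · intro h y hy
    exact h (Submodule.smul_mem_pointwise_smul y x J hy)
  · intro h y hy
    obtain ⟨z, hz, rfl⟩ := Submodule.mem_smul_pointwise_iff_exists y x _ |>.1 hy
    exact h z hz

theorem add_smul_mul_le {x y : K} {I J A : Submodule R K} (hI1 : I ≤ 1) (hJ1 : J ≤ 1)
    (hx : x • I ≤ A) (hy : y • J ≤ A) : (x + y) • (I * J) ≤ A := by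
  have h1 : I * J ≤ I := (mul_le_mul' le_rfl hJ1).trans (by simp)
  have h2 : I * J ≤ J := (mul_le_mul' hI1 le_rfl).trans (by simp)
  rw [smul_le_iff] at *
  intro z hz
  rw [add_mul]
  exact add_mem (hx _ (h1 hz)) (hy _ (h2 hz))

theorem smul_smul_le {x : K} {J A : Submodule R K} (hx : x • J ≤ A) (r : R) :
    (r • x) • J ≤ A := by
  rw [smul_le_iff] at *
  intro z hz
  rw [smul_mul_assoc]
  exact Submodule.smul_mem _ r (hx z hz)

theorem mem_div_iff {x : K} {I A : Submodule R K} : x ∈ A / I ↔ x • I ≤ A := by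
  rw [smul_le_iff, Submodule.mem_div_iff_forall_mul_mem]

theorem coe_tilde {s : Submodule R K → Submodule R K} (hs : IsStar s) (A : Submodule R K) :
    (tilde s A : Set K) = {x | ∃ J ∈ F R K, J.FG ∧ J ≤ 1 ∧ s J = 1 ∧ x • J ≤ A} := by
  apply coe_span_eq
  · exact ⟨0, 1, one_mem_F, by rw [Submodule.one_eq_span]; exact Submodule.fg_span_singleton 1,
      le_rfl, by simpa using hs.principal 1 one_ne_zero, by simp⟩
  · rintro x ⟨I, hI, hIf, hI1, hsI, hx⟩ y ⟨J, hJ, hJf, hJ1, hsJ, hy⟩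
    exact ⟨I * J, mul_mem_F hI hJ, hIf.mul hJf, (mul_le_mul' hI1 hJ1).trans (by simp),
      hs.mul_eq_one hI hJ hI1 hJ1 hsI hsJ, add_smul_mul_le hI1 hJ1 hx hy⟩
  · rintro r x ⟨J, hJ, hJf, hJ1, hsJ, hx⟩
    exact ⟨J, hJ, hJf, hJ1, hsJ, smul_smul_le hx r⟩

theorem coe_bar {s : Submodule R K → Submodule R K} (hs : IsStar s) (A : Submodule R K) :
    (bar s A : Set K) = {x | ∃ I ∈ F R K, I ≤ 1 ∧ s I = 1 ∧ x ∈ A / I} := by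
  simp only [mem_div_iff, bar]
  apply coe_span_eq
  · exact ⟨0, 1, one_mem_F, le_rfl, by simpa using hs.principal 1 one_ne_zero, by simp⟩
  · rintro x ⟨I, hI, hI1, hsI, hx⟩ y ⟨J, hJ, hJ1, hsJ, hy⟩
    exact ⟨I * J, mul_mem_F hI hJ, (mul_le_mul' hI1 hJ1).trans (by simp),
      hs.mul_eq_one hI hJ hI1 hJ1 hsI hsJ, add_smul_mul_le hI1 hJ1 hx hy⟩
  · rintro r x ⟨J, hJ, hJ1, hsJ, hx⟩
    exact ⟨J, hJ, hJ1, hsJ, smul_smul_le hx r⟩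

end Classical

/-! ### Graded domains, homogeneous fractional ideals, homogeneous star operations -/

section Graded

variable {Γ R : Type*} [AddCommMonoid Γ] [DecidableEq Γ] [CommRing R] [IsDomain R]
variable (𝒜 : Γ → AddSubgroup R) [GradedRing 𝒜]
variable (K : Type*) [Field K] [Algebra R K] [IsFractionRing R K]

/-- `H 𝒜` is the set of nonzero homogeneous elements of `R`. -/
def H : Set R := {a | SetLike.IsHomogeneousElem 𝒜 a ∧ a ≠ 0}

variable {K}

/-- `x` is a nonzero homogeneous element of the homogeneous quotient field `R_H`, that is, a
quotient of two nonzero homogeneous elements of `R`. -/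
def IsHomogeneousUnit (x : K) : Prop :=
  ∃ a ∈ H 𝒜, ∃ t ∈ H 𝒜, x = algebraMap R K a / algebraMap R K t

variable (K)

/-- The homogeneous quotient field `R_H`, as a subset of `K`. -/
def RH : Set K := {x | ∃ a : R, ∃ t ∈ H 𝒜, x = algebraMap R K a / algebraMap R K t}

/-- `HF 𝒜 K` is the set of nonzero homogeneous fractional ideals of `R`: the nonzero `A` such that
`tA` is a homogeneous ideal of `R` for some `t ∈ H`. -/
def HF : Set (Submodule R K) :=
  {A | A ≠ ⊥ ∧ ∃ t ∈ H 𝒜, ∃ I : Ideal R, I.IsHomogeneous 𝒜 ∧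
    algebraMap R K t • A = IsLocalization.coeSubmodule K I}

variable {K}

/-- The fractional ideal `C(f)` generated by the homogeneous components of `f ∈ R_H`. If
`f = a / t` with `a ∈ R` and `t ∈ H`, these components are the `a_α / t`, where the `a_α` are the
homogeneous components of `a`; all representations `a / t` of `f` yield the same nonzero
components. -/
def content (f : K) : Submodule R K :=
  Submodule.span R {y | ∃ a : R, ∃ t ∈ H 𝒜, ∃ α : Γ, f = algebraMap R K a / algebraMap R K t ∧
    y = algebraMap R K (DirectSum.decompose 𝒜 a α : R) / algebraMap R K t}

/-- `C(A)` is the sum of the `C(f)` for `f ∈ A` (to be used for `A ⊆ R_H`). -/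
def contentIdeal (A : Submodule R K) : Submodule R K :=
  ⨆ f ∈ A, content 𝒜 f

/-- The map `s` (only its values on `HF 𝒜 K` matter) is a homogeneous star operation. -/
structure IsHomStar (s : Submodule R K → Submodule R K) : Prop where
  mem : ∀ A ∈ HF 𝒜 K, s A ∈ HF 𝒜 K
  principal : ∀ x : K, IsHomogeneousUnit 𝒜 x → s (x • 1) = x • 1
  smul : ∀ x : K, IsHomogeneousUnit 𝒜 x → ∀ A ∈ HF 𝒜 K, s (x • A) = x • s A
  le : ∀ A ∈ HF 𝒜 K, A ≤ s A
  mono : ∀ A ∈ HF 𝒜 K, ∀ B ∈ HF 𝒜 K, A ≤ B → s A ≤ s B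
  idem : ∀ A ∈ HF 𝒜 K, s (s A) = s A

/-- The homogeneous star operation of finite type associated to `s`: `A` goes to the union of the
`s B`, for the nonzero finitely generated homogeneous fractional ideals `B ⊆ A`
(see `coe_homFiniteType`). -/
def homFiniteType (s : Submodule R K → Submodule R K) (A : Submodule R K) : Submodule R K :=
  Submodule.span R {x | ∃ B ∈ HF 𝒜 K, B.FG ∧ B ≤ A ∧ x ∈ s B}

/-- The homogeneous version of `tilde`: `A` goes to the set of the `x ∈ R_H` with `xJ ⊆ A` for some
nonzero finitely generated homogeneous ideal `J` of `R` with `s J = R` (see `coe_homTilde`). -/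
def homTilde (s : Submodule R K → Submodule R K) (A : Submodule R K) : Submodule R K :=
  Submodule.span R
    {x | x ∈ RH 𝒜 K ∧ ∃ J ∈ HF 𝒜 K, J.FG ∧ J ≤ 1 ∧ s J = 1 ∧ x • J ≤ A}

/-- The homogeneous version of `bar`: `A` goes to the union of the `(A : I)`, for the nonzero
homogeneous ideals `I` of `R` with `s I = R` (see `coe_homBar`). -/
def homBar (s : Submodule R K → Submodule R K) (A : Submodule R K) : Submodule R K :=
  Submodule.span R {x | ∃ I ∈ HF 𝒜 K, I ≤ 1 ∧ s I = 1 ∧ x ∈ A / I}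

/-! The sets that are spanned in the last three operations are submodules already. -/

variable {𝒜}

theorem one_mem_H : (1 : R) ∈ H 𝒜 := ⟨SetLike.isHomogeneousElem_one 𝒜, one_ne_zero⟩

theorem mul_mem_H {a b : R} (ha : a ∈ H 𝒜) (hb : b ∈ H 𝒜) : a * b ∈ H 𝒜 :=
  ⟨SetLike.IsHomogeneousElem.mul ha.1 hb.1, mul_ne_zero ha.2 hb.2⟩

theorem coeSubmodule_span_mul (a : R) (I : Ideal R) :
    IsLocalization.coeSubmodule K (Ideal.span {a} * I) =
      algebraMap R K a • IsLocalization.coeSubmodule K I := by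
  ext x
  simp only [IsLocalization.mem_coeSubmodule, Ideal.mem_span_singleton_mul,
    Submodule.mem_smul_pointwise_iff_exists, smul_eq_mul]
  constructor
  · rintro ⟨_, ⟨z, hz, rfl⟩, rfl⟩
    exact ⟨_, ⟨z, hz, rfl⟩, by simp⟩
  · rintro ⟨_, ⟨z, hz, rfl⟩, rfl⟩
    exact ⟨_, ⟨z, hz, rfl⟩, by simp⟩

theorem isHomogeneous_span_mul {a : R} (ha : a ∈ H 𝒜) {I : Ideal R} (hI : I.IsHomogeneous 𝒜) :
    (Ideal.span {a} * I).IsHomogeneous 𝒜 :=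
  (Ideal.homogeneous_span 𝒜 {a} (by rintro x rfl; exact ha.1)).mul hI

theorem algebraMap_ne_zero_of_mem_H {a : R} (ha : a ∈ H 𝒜) : algebraMap R K a ≠ 0 :=
  (map_ne_zero_iff _ (IsFractionRing.injective R K)).2 ha.2

theorem one_mem_HF : (1 : Submodule R K) ∈ HF 𝒜 K :=
  ⟨one_ne_zero, 1, one_mem_H, ⊤, Ideal.IsHomogeneous.top 𝒜, by simp⟩

theorem mul_mem_HF {A B : Submodule R K} (hA : A ∈ HF 𝒜 K) (hB : B ∈ HF 𝒜 K) :
    A * B ∈ HF 𝒜 K := by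
  obtain ⟨hA0, t, ht, I, hI, htI⟩ := hA
  obtain ⟨hB0, u, hu, J, hJ, huJ⟩ := hB
  refine ⟨?_, t * u, mul_mem_H ht hu, I * J, hI.mul hJ, ?_⟩
  · obtain ⟨a, ha, ha0⟩ := (Submodule.ne_bot_iff A).1 hA0
    obtain ⟨b, hb, hb0⟩ := (Submodule.ne_bot_iff B).1 hB0
    exact (Submodule.ne_bot_iff _).2 ⟨a * b, Submodule.mul_mem_mul ha hb, mul_ne_zero ha0 hb0⟩
  · rw [IsLocalization.coeSubmodule_mul, ← htI, ← huJ, map_mul, smul_mul_smul_comm]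

theorem sup_mem_HF {A B : Submodule R K} (hA : A ∈ HF 𝒜 K) (hB : B ∈ HF 𝒜 K) :
    A ⊔ B ∈ HF 𝒜 K := by
  obtain ⟨hA0, t, ht, I, hI, htI⟩ := hA
  obtain ⟨hB0, u, hu, J, hJ, huJ⟩ := hB
  refine ⟨fun h => hA0 (le_bot_iff.1 (h ▸ le_sup_left)), t * u, mul_mem_H ht hu,
    Ideal.span {u} * I ⊔ Ideal.span {t} * J,
    (isHomogeneous_span_mul hu hI).sup (isHomogeneous_span_mul ht hJ), ?_⟩
  rw [IsLocalization.coeSubmodule_sup, coeSubmodule_span_mul, coeSubmodule_span_mul, ← htI, ← huJ,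
    Submodule.smul_sup', smul_smul, smul_smul, map_mul, mul_comm (algebraMap R K u)]

theorem smul_mem_HF {x : K} (hx : IsHomogeneousUnit 𝒜 x) {A : Submodule R K} (hA : A ∈ HF 𝒜 K) :
    x • A ∈ HF 𝒜 K := by
  obtain ⟨a, ha, t, ht, rfl⟩ := hx
  obtain ⟨hA0, u, hu, I, hI, huI⟩ := hA
  have ha0 : algebraMap R K a ≠ 0 := algebraMap_ne_zero_of_mem_H ha
  have ht0 : algebraMap R K t ≠ 0 := algebraMap_ne_zero_of_mem_H ht
  refine ⟨?_, t * u, mul_mem_H ht hu, Ideal.span {a} * I, isHomogeneous_span_mul ha hI, ?_⟩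
  · obtain ⟨b, hb, hb0⟩ := (Submodule.ne_bot_iff A).1 hA0
    exact (Submodule.ne_bot_iff _).2 ⟨_, Submodule.smul_mem_pointwise_smul b _ A hb,
      mul_ne_zero (div_ne_zero ha0 ht0) hb0⟩
  · rw [coeSubmodule_span_mul, ← huI, smul_smul, smul_smul, map_mul]
    congr 1
    field_simp

theorem isHomogeneousUnit_one : IsHomogeneousUnit 𝒜 (1 : K) :=
  ⟨1, one_mem_H, 1, one_mem_H, by simp⟩

theorem IsHomStar.map_one {s : Submodule R K → Submodule R K} (hs : IsHomStar 𝒜 s) : s 1 = 1 := by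
  simpa using hs.principal 1 isHomogeneousUnit_one

/-- A homogeneous fractional ideal is contained in a submodule that contains all of its nonzero
homogeneous elements. -/
theorem le_of_forall_homogeneousUnit {A N : Submodule R K} (hA : A ∈ HF 𝒜 K)
    (h : ∀ x ∈ A, IsHomogeneousUnit 𝒜 x → x ∈ N) : A ≤ N := by
  classical
  obtain ⟨hA0, t, ht, I, hI, htI⟩ := hA
  have ht0 : algebraMap R K t ≠ 0 := algebraMap_ne_zero_of_mem_H ht
  intro x hx
  have hx' : algebraMap R K t * x ∈ IsLocalization.coeSubmodule K I :=
    htI ▸ Submodule.smul_mem_pointwise_smul x _ A hx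
  obtain ⟨r, hr, hrx⟩ := (IsLocalization.mem_coeSubmodule K I).1 hx'
  have hxe : x = ∑ i ∈ (DirectSum.decompose 𝒜 r).support,
      algebraMap R K (DirectSum.decompose 𝒜 r i : R) / algebraMap R K t := by
    rw [← Finset.sum_div, ← map_sum, DirectSum.sum_support_decompose, hrx]
    field_simp
  rw [hxe]
  refine Submodule.sum_mem _ fun i hi => h _ ?_ ⟨_, ⟨⟨i, SetLike.coe_mem _⟩, ?_⟩, t, ht, rfl⟩
  · have hi' : algebraMap R K (DirectSum.decompose 𝒜 r i : R) ∈ algebraMap R K t • A := by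
      rw [htI]
      exact (IsLocalization.mem_coeSubmodule K I).2 ⟨_, hI i hr, rfl⟩
    obtain ⟨z, hz, hze⟩ := (Submodule.mem_smul_pointwise_iff_exists _ _ _).1 hi'
    rw [← hze, smul_eq_mul, mul_div_cancel_left₀ _ ht0]
    exact hz
  · simpa using hi

theorem IsHomStar.mul_eq_one {s : Submodule R K → Submodule R K} (hs : IsHomStar 𝒜 s)
    {I J : Submodule R K} (hI : I ∈ HF 𝒜 K) (hJ : J ∈ HF 𝒜 K) (hI1 : I ≤ 1) (hJ1 : J ≤ 1)
    (hsI : s I = 1) (hsJ : s J = 1) : s (I * J) = 1 := by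
  have hIJ := mul_mem_HF hI hJ
  apply le_antisymm
  · rw [← hs.map_one]
    exact hs.mono _ hIJ _ one_mem_HF ((mul_le_mul' hI1 hJ1).trans (by simp))
  · have hle : I ≤ s (I * J) := by
      refine le_of_forall_homogeneousUnit hI fun x hx hxu => ?_
      have hxJ : x • J ≤ I * J := by
        rw [smul_le_iff]
        exact fun z hz => Submodule.mul_mem_mul hx hz
      have h2 := hs.mono _ (smul_mem_HF hxu hJ) _ hIJ hxJ
      rw [hs.smul x hxu J hJ, hsJ] at h2
      apply h2
      simpa using Submodule.smul_mem_pointwise_smul (1 : K) x _ (Submodule.one_le.1 le_rfl)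
    calc (1 : Submodule R K) = s I := hsI.symm
      _ ≤ s (s (I * J)) := hs.mono _ hI _ (hs.mem _ hIJ) hle
      _ = s (I * J) := hs.idem _ hIJ

theorem coe_homFiniteType {s : Submodule R K → Submodule R K} (hs : IsHomStar 𝒜 s)
    {A : Submodule R K} (hA : A ∈ HF 𝒜 K) :
    (homFiniteType 𝒜 s A : Set K) = {x | ∃ B ∈ HF 𝒜 K, B.FG ∧ B ≤ A ∧ x ∈ s B} := by
  apply coe_span_eq
  · obtain ⟨x, hx, hxu⟩ : ∃ x ∈ A, IsHomogeneousUnit 𝒜 x := by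
      by_contra! hc
      exact hA.1 (le_bot_iff.1 (le_of_forall_homogeneousUnit hA fun x hx hxu => (hc x hx hxu).elim))
    refine ⟨0, x • 1, smul_mem_HF hxu one_mem_HF, ?_, ?_, zero_mem _⟩
    · rw [Submodule.one_eq_span, Submodule.smul_span, Set.smul_set_singleton]
      exact Submodule.fg_span_singleton _
    · rw [Submodule.one_eq_span, Submodule.smul_span, Set.smul_set_singleton]
      simpa using hx
  · rintro x ⟨B, hB, hBf, hBA, hx⟩ y ⟨C, hC, hCf, hCA, hy⟩
    have hBC := sup_mem_HF hB hC
    exact ⟨B ⊔ C, hBC, hBf.sup hCf, sup_le hBA hCA,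
      add_mem (hs.mono _ hB _ hBC le_sup_left hx) (hs.mono _ hC _ hBC le_sup_right hy)⟩
  · rintro r x ⟨B, hB, hBf, hBA, hx⟩
    exact ⟨B, hB, hBf, hBA, Submodule.smul_mem _ r hx⟩

theorem coe_homTilde {s : Submodule R K → Submodule R K} (hs : IsHomStar 𝒜 s)
    (A : Submodule R K) :
    (homTilde 𝒜 s A : Set K) =
      {x | x ∈ RH 𝒜 K ∧ ∃ J ∈ HF 𝒜 K, J.FG ∧ J ≤ 1 ∧ s J = 1 ∧ x • J ≤ A} := by
  apply coe_span_eq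
  · exact ⟨0, ⟨0, 1, one_mem_H, by simp⟩, 1, one_mem_HF,
      by rw [Submodule.one_eq_span]; exact Submodule.fg_span_singleton 1,
      le_rfl, hs.map_one, by simp⟩
  · rintro x ⟨⟨a, t, ht, rfl⟩, I, hI, hIf, hI1, hsI, hx⟩ y
      ⟨⟨b, u, hu, rfl⟩, J, hJ, hJf, hJ1, hsJ, hy⟩
    refine ⟨⟨a * u + t * b, t * u, mul_mem_H ht hu, ?_⟩, I * J, mul_mem_HF hI hJ, hIf.mul hJf,
      (mul_le_mul' hI1 hJ1).trans (by simp), hs.mul_eq_one hI hJ hI1 hJ1 hsI hsJ,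
      add_smul_mul_le hI1 hJ1 hx hy⟩
    rw [div_add_div _ _ (algebraMap_ne_zero_of_mem_H ht) (algebraMap_ne_zero_of_mem_H hu)]
    simp
  · rintro r x ⟨⟨a, t, ht, rfl⟩, J, hJ, hJf, hJ1, hsJ, hx⟩
    exact ⟨⟨r * a, t, ht, by rw [Algebra.smul_def, map_mul, mul_div_assoc]⟩, J, hJ, hJf, hJ1, hsJ,
      smul_smul_le hx r⟩

theorem coe_homBar {s : Submodule R K → Submodule R K} (hs : IsHomStar 𝒜 s)
    (A : Submodule R K) :
    (homBar 𝒜 s A : Set K) = {x | ∃ I ∈ HF 𝒜 K, I ≤ 1 ∧ s I = 1 ∧ x ∈ A / I} := by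
  simp only [mem_div_iff, homBar]
  apply coe_span_eq
  · exact ⟨0, 1, one_mem_HF, le_rfl, hs.map_one, by simp⟩
  · rintro x ⟨I, hI, hI1, hsI, hx⟩ y ⟨J, hJ, hJ1, hsJ, hy⟩
    exact ⟨I * J, mul_mem_HF hI hJ, (mul_le_mul' hI1 hJ1).trans (by simp),
      hs.mul_eq_one hI hJ hI1 hJ1 hsI hsJ, add_smul_mul_le hI1 hJ1 hx hy⟩
  · rintro r x ⟨J, hJ, hJ1, hsJ, hx⟩
    exact ⟨J, hJ, hJ1, hsJ, smul_smul_le hx r⟩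

variable (𝒜)

/-- The extension `e(s)` of the homogeneous star operation `s` to all fractional ideals: `A` goes to
the intersection of the `z⁻¹ (C(zA))ˢ` for `0 ≠ z ∈ (R : A)`. -/
def e (s : Submodule R K → Submodule R K) (A : Submodule R K) : Submodule R K :=
  ⨅ z : K, ⨅ _ : z ≠ 0 ∧ z ∈ 1 / A, z⁻¹ • s (contentIdeal 𝒜 (z • A))

/-- The star operation `t` is an extension of the homogeneous star operation `s`. -/
structure IsExtension (t s : Submodule R K → Submodule R K) : Prop where
  isHomStar : IsHomStar 𝒜 s
  isStar : IsStar t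
  eqOn : Set.EqOn t s (HF 𝒜 K)

/-- `t` is the largest among the star operations with the property `P` that extend `s`. -/
structure IsLargestExtension (P : (Submodule R K → Submodule R K) → Prop)
    (t s : Submodule R K → Submodule R K) : Prop where
  isExtension : IsExtension 𝒜 t s
  prop : P t
  le : ∀ t', IsExtension 𝒜 t' s → P t' → ∀ A ∈ F R K, t' A ≤ t A

end Graded

end GradedStar

namespace GradedStar

/-! ### Unique sums and multiplication by homogeneous components -/

/-! The extension `e s` is the largest star operation extending `s`. If `t` is a star operation that
is at most `s` on homogeneous ideals, then for `0 ≠ z` with `zA ⊆ R` one has `z t(A) = t(zA) ⊆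
t(C(zA)) ⊆ s(C(zA))`, hence `t ≤ e s` (`IsStar.le_e`). That `e s` agrees with `s` on homogeneous
ideals is `e_eq`.

Let `Φ` be one of `finiteType`, `tilde`, `bar`, let `s'` be its homogeneous counterpart applied to
`s`, and let `P` be the corresponding property. `Φ` is monotone, and `t ≤ Φ t` for star operations
`t` with property `P`. So every extension `t` of `s'` with property `P` satisfies `t ≤ Φ t ≤ Φ (e
s') ≤ Φ (e s)`, the last step because `s' ≤ s`. If `Φ (e s)` itself extends `s'` and has property
`P`, it may be taken as `t`, and both the equality and the maximality follow
(`isLargestExtension_of_mono`).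

It remains to see that `Φ` carries extensions to extensions. For `finiteType`, finitely generated
ideals are enlarged to finitely generated homogeneous ones by taking contents. Since `tilde` is
`bar` after `finiteType`, the essential case is `bar` (`IsExtension.bar`): from `xI ⊆ A` with `A`
homogeneous and `I` arbitrary, one must pass to homogeneous ideals, although `x C(I) ⊆ A` may fail.
Here torsion-freeness of `Γ` enters. Finite sets of degrees have a uniquely represented sum, and an
induction on the number of degrees of `x` (`mem_of_forall_mul_mem`) shows that `x` lies in every
homogeneous `B` containing `xI`, provided that `B` contains each homogeneous `c` with `c C(I) ⊆ B`.
The closure of `A` under `homBar s` is such a `B`, by idempotence. -/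

/-- Two nonempty finite subsets of a torsion-free cancellative commutative monoid have a sum with
a unique representation. -/
theorem exists_uniqueAdd {Γ : Type*} [AddCancelCommMonoid Γ] [IsAddTorsionFree Γ]
    {A B : Finset Γ} (hA : A.Nonempty) (hB : B.Nonempty) :
    ∃ a ∈ A, ∃ b ∈ B, UniqueAdd A B a b := by
  classical
  -- Only finitely many degrees are involved, so one may pass to the finitely generated submonoid
  -- `M`, which is an affine monoid.
  let M : AddSubmonoid Γ := AddSubmonoid.closure ((A ∪ B : Finset Γ) : Set Γ)
  have hAM : ∀ a ∈ A, a ∈ M := fun a ha => AddSubmonoid.subset_closure (by simp [ha])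
  have hBM : ∀ b ∈ B, b ∈ M := fun b hb => AddSubmonoid.subset_closure (by simp [hb])
  have : AddMonoid.FG M :=
    (AddMonoid.fg_iff_addSubmonoid_fg M).2 ⟨A ∪ B, rfl⟩
  have : IsAddTorsionFree M :=
    Function.Injective.isAddTorsionFree M.subtype Subtype.val_injective
  let _ : AddCancelCommMonoid M :=
    { (inferInstance : AddCommMonoid M) with add_left_cancel := fun _ _ _ h => add_left_cancel h }
  have : TwoUniqueSums M := AffineAddMonoid.to_twoUniqueSums
  obtain ⟨a, ha, b, hb, hu⟩ := UniqueSums.uniqueAdd_of_nonempty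
    (A := A.subtype (· ∈ M)) (B := B.subtype (· ∈ M))
    (by obtain ⟨a, ha⟩ := hA; exact ⟨⟨a, hAM a ha⟩, by simpa using ha⟩)
    (by obtain ⟨b, hb⟩ := hB; exact ⟨⟨b, hBM b hb⟩, by simpa using hb⟩)
  refine ⟨a, by simpa using ha, b, by simpa using hb, fun a' b' ha' hb' hab => ?_⟩
  have := @hu ⟨a', hAM a' ha'⟩ ⟨b', hBM b' hb'⟩ (by simpa using ha') (by simpa using hb')
    (Subtype.ext hab)
  simpa [Subtype.ext_iff] using this

section

variable {Γ R : Type*} [AddCancelCommMonoid Γ] [DecidableEq Γ] [CommRing R]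
variable (𝒜 : Γ → AddSubgroup R) [GradedRing 𝒜]

theorem coe_decompose_sum {ι : Type*} (S : Finset ι) (f : ι → R) (k : Γ) :
    (DirectSum.decompose 𝒜 (∑ i ∈ S, f i) k : R) = ∑ i ∈ S, (DirectSum.decompose 𝒜 (f i) k : R) :=
  map_sum (GradedRing.proj 𝒜 k) f S

/-- The component of a product in a degree that is uniquely a sum of degrees of the factors. -/
theorem decompose_mul_of_uniqueAdd {g x : R} {S T : Finset Γ} {i j : Γ}
    (h : UniqueAdd S T i j) (hi : i ∈ S) (hj : j ∈ T)
    (hg : ∀ k ∉ S, (DirectSum.decompose 𝒜 g k : R) = 0)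
    (hx : ∀ k ∉ T, (DirectSum.decompose 𝒜 x k : R) = 0) :
    (DirectSum.decompose 𝒜 (g * x) (i + j) : R) =
      DirectSum.decompose 𝒜 g i * DirectSum.decompose 𝒜 x j := by
  classical
  rw [DirectSum.decompose_mul, DirectSum.coe_mul_apply]
  rw [Finset.sum_eq_single (i, j)]
  · rintro ⟨a, b⟩ hab hne
    simp only [Finset.mem_filter, Finset.mem_product] at hab
    by_cases ha : a ∈ S
    · by_cases hb : b ∈ T
      · obtain ⟨rfl, rfl⟩ := h ha hb hab.2
        exact absurd rfl hne
      · rw [hx b hb, mul_zero]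
    · rw [hg a ha, zero_mul]
  · intro hij
    simp only [Finset.mem_filter, Finset.mem_product, DFinsupp.mem_support_toFun, and_true,
      not_and_or, not_not] at hij
    rcases hij with h0 | h0 <;> simp [h0]

/-- If `x` multiplies `G` into the homogeneous ideal `B`, and every homogeneous element that
multiplies all components of elements of `G` into `B` is in `B`, then `x ∈ B`. -/
theorem mem_of_forall_mul_mem [IsAddTorsionFree Γ] {B : Ideal R} (hB : B.IsHomogeneous 𝒜)
    {G : Set R}
    (hc : ∀ c, SetLike.IsHomogeneousElem 𝒜 c →
      (∀ g ∈ G, ∀ j, c * (DirectSum.decompose 𝒜 g j : R) ∈ B) → c ∈ B)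
    {x : R} (hx : ∀ g ∈ G, x * g ∈ B) : x ∈ B := by
  classical
  suffices H : ∀ (n : ℕ) (T : Finset Γ), T.card = n → ∀ x : R,
      (∀ k ∉ T, (DirectSum.decompose 𝒜 x k : R) = 0) → (∀ g ∈ G, x * g ∈ B) → x ∈ B from
    H _ (DirectSum.decompose 𝒜 x).support rfl x (by simp) hx
  intro n
  induction n with
  | zero =>
    intro T hT x hxT _
    rw [Finset.card_eq_zero.1 hT] at hxT
    have : x = 0 := by
      rw [← DirectSum.sum_support_decompose 𝒜 x]
      exact Finset.sum_eq_zero fun i _ => hxT i (Finset.notMem_empty i)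
    simp [this]
  | succ n ih =>
    intro T hT x hxT hx
    have hTn : T.Nonempty := Finset.card_pos.1 (by omega)
    -- Otherwise let `S` be the set of degrees `j` with `x g_j ∉ B`. Removing the other components
    -- from `g` leaves `g'` with `x g' ∈ B`, and a unique sum `j + m` of `S + T` isolates `g_j x_m`
    -- as a component of `g' x`.
    have key : ∀ g ∈ G, ∀ j, x * (DirectSum.decompose 𝒜 g j : R) ∈ B := by
      intro g hg
      by_contra! hbad
      let S := (DirectSum.decompose 𝒜 g).support.filter
        fun j => x * (DirectSum.decompose 𝒜 g j : R) ∉ B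
      have hSn : S.Nonempty := by
        obtain ⟨j, hj⟩ := hbad
        refine ⟨j, Finset.mem_filter.2 ⟨?_, hj⟩⟩
        rw [DFinsupp.mem_support_toFun]
        intro h0
        exact hj (by simp [h0])
      obtain ⟨j, hj, m, hm, hu⟩ := exists_uniqueAdd hSn hTn
      let g' := ∑ i ∈ S, (DirectSum.decompose 𝒜 g i : R)
      have hdec : ∀ k, (DirectSum.decompose 𝒜 g' k : R) =
          if k ∈ S then (DirectSum.decompose 𝒜 g k : R) else 0 := by
        intro k
        simp only [g', coe_decompose_sum, DirectSum.decompose_coe, DirectSum.coe_of_apply]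
        rw [← Finset.sum_ite_eq S k fun i => (DirectSum.decompose 𝒜 g i : R)]
        refine Finset.sum_congr rfl fun i _ => ?_
        by_cases h : i = k
        · subst h; simp
        · simp [h, Ne.symm h]
      have hg'B : g' * x ∈ B := by
        have hsplit : g' = g - ∑ i ∈ (DirectSum.decompose 𝒜 g).support.filter
            (fun j => ¬ x * (DirectSum.decompose 𝒜 g j : R) ∉ B),
            (DirectSum.decompose 𝒜 g i : R) := by
          rw [eq_sub_iff_add_eq, Finset.sum_filter_add_sum_filter_not,
            DirectSum.sum_support_decompose]
        rw [hsplit, mul_comm, mul_sub, Finset.mul_sum]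
        refine sub_mem (hx g hg) (sum_mem fun i hi => ?_)
        simpa using (Finset.mem_filter.1 hi).2
      have h1 : (DirectSum.decompose 𝒜 g j : R) * DirectSum.decompose 𝒜 x m ∈ B := by
        have := hB (j + m) hg'B
        rw [decompose_mul_of_uniqueAdd 𝒜 hu hj hm (fun k hk => by rw [hdec, if_neg hk]) hxT,
          hdec, if_pos hj] at this
        exact this
      set gj : R := (DirectSum.decompose 𝒜 g j : R) with hgj
      set xm : R := (DirectSum.decompose 𝒜 x m : R) with hxm
      -- The induction hypothesis is applied to `g_j (x - x_m)`, not to `x - x_m`: it still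
      -- multiplies `G` into `B` because `g_j x_m ∈ B`, and its degrees lie in a translate of `T`
      -- without `m`.
      have h2 : gj * (x - xm) ∈ B := by
        refine ih ((T.erase m).image (j + ·)) ?_ _ ?_ ?_
        · rw [Finset.card_image_of_injective _ (add_right_injective j),
            Finset.card_erase_of_mem hm, hT]
          rfl
        · intro k hk
          have hterm : gj * (x - xm) =
              ∑ i ∈ (DirectSum.decompose 𝒜 (x - xm)).support,
                gj * (DirectSum.decompose 𝒜 (x - xm) i : R) := by
            rw [← Finset.mul_sum, DirectSum.sum_support_decompose]
          rw [hterm, coe_decompose_sum]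
          refine Finset.sum_eq_zero fun i _ => ?_
          by_cases hi : i ∈ T.erase m
          · refine DirectSum.decompose_of_mem_ne 𝒜
              (SetLike.GradedMul.mul_mem (SetLike.coe_mem _) (SetLike.coe_mem _)) ?_
            rintro rfl
            exact hk (Finset.mem_image_of_mem _ hi)
          · have : (DirectSum.decompose 𝒜 (x - xm) i : R) = 0 := by
              rw [DirectSum.decompose_sub, DirectSum.sub_apply, AddSubgroup.coe_sub, hxm,
                DirectSum.decompose_coe, DirectSum.coe_of_apply]
              by_cases him : m = i
              · subst him; simp
              · have : i ∉ T := fun h => hi (Finset.mem_erase.2 ⟨Ne.symm him, h⟩)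
                simp [him, hxT i this]
            rw [this, mul_zero, DirectSum.decompose_zero]
            rfl
        · intro g'' hg''
          have : gj * (x - xm) * g'' = gj * (x * g'') - g'' * (gj * xm) := by ring
          rw [this]
          exact sub_mem (B.mul_mem_left _ (hx _ hg'')) (B.mul_mem_left _ h1)
      apply (Finset.mem_filter.1 hj).2
      have : x * gj = gj * (x - xm) + gj * xm := by ring
      rw [← hgj, this]
      exact add_mem h2 h1
    -- With `x g_j ∈ B` for all components of all `g`, homogeneity of `B` gives `x_m g_j ∈ B`, so
    -- `hc` applies to every component `x_m`.
    rw [← DirectSum.sum_support_decompose 𝒜 x]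
    refine sum_mem fun m _ => hc _ ⟨m, SetLike.coe_mem _⟩ fun g hg j => ?_
    have := hB (m + j) (key g hg j)
    rwa [DirectSum.coe_decompose_mul_add_of_right_mem 𝒜 (SetLike.coe_mem _)] at this

end

/-! ### Dilations of submodules of a field -/

section Dilation

variable {R K : Type*} [CommRing R] [Field K] [Algebra R K]

theorem mem_smul_iff {x y : K} (hx : x ≠ 0) {A : Submodule R K} : y ∈ x • A ↔ x⁻¹ * y ∈ A := by
  rw [Submodule.mem_smul_pointwise_iff_exists]
  constructor
  · rintro ⟨z, hz, rfl⟩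
    simpa [hx] using hz
  · intro h
    exact ⟨_, h, by simp [hx]⟩

theorem smul_le_smul {A B : Submodule R K} (x : K) (h : A ≤ B) : x • A ≤ x • B :=
  Submodule.map_mono h

theorem smul_le_iff_le_inv_smul {x : K} (hx : x ≠ 0) {A B : Submodule R K} :
    x • A ≤ B ↔ A ≤ x⁻¹ • B := by
  constructor <;> intro h
  · simpa [smul_smul, hx] using smul_le_smul x⁻¹ h
  · simpa [smul_smul, hx] using smul_le_smul x h

theorem mem_smul_one {x : K} : x ∈ x • (1 : Submodule R K) := by
  simpa using Submodule.smul_mem_pointwise_smul (1 : K) x (1 : Submodule R K)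
    (Submodule.one_le.1 le_rfl)

theorem smul_one_le {x : K} {A : Submodule R K} (hx : x ∈ A) : x • (1 : Submodule R K) ≤ A := by
  rw [Submodule.one_eq_span, Submodule.smul_span, Set.smul_set_singleton]
  simpa using hx

theorem fg_smul {A : Submodule R K} (hA : A.FG) (x : K) : (x • A).FG := hA.map _

theorem fg_one : (1 : Submodule R K).FG := by
  rw [Submodule.one_eq_span]
  exact Submodule.fg_span_singleton 1

theorem smul_ne_bot {x : K} (hx : x ≠ 0) {A : Submodule R K} (hA : A ≠ ⊥) : x • A ≠ ⊥ := by
  obtain ⟨b, hb, hb0⟩ := (Submodule.ne_bot_iff A).1 hA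
  exact (Submodule.ne_bot_iff _).2
    ⟨_, Submodule.smul_mem_pointwise_smul b x A hb, mul_ne_zero hx hb0⟩

end Dilation

/-! ### Homogeneous fractional ideals -/

section Graded

variable {Γ R : Type*} [AddCancelCommMonoid Γ] [DecidableEq Γ] [CommRing R] [IsDomain R]
variable (𝒜 : Γ → AddSubgroup R) [GradedRing 𝒜]
variable {K : Type*} [Field K] [Algebra R K] [IsFractionRing R K]

/-- `B` contains the homogeneous components of its elements that lie in `R_H`. -/
def ComponentClosed (B : Submodule R K) : Prop :=
  ∀ r : R, ∀ t ∈ H 𝒜, algebraMap R K r / algebraMap R K t ∈ B →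
    ∀ α, algebraMap R K (DirectSum.decompose 𝒜 r α : R) / algebraMap R K t ∈ B

variable {𝒜}

theorem mem_one_iff {x : K} : x ∈ (1 : Submodule R K) ↔ ∃ r, algebraMap R K r = x :=
  Submodule.mem_one

theorem algebraMap_mem_one (r : R) : algebraMap R K r ∈ (1 : Submodule R K) :=
  mem_one_iff.2 ⟨r, rfl⟩

/-- Splits homogeneity into a homogeneous common denominator and a condition on components that
refers to no chosen denominator. The latter passes to intersections, and the former to submodules.
-/
theorem mem_HF_iff {B : Submodule R K} :
    B ∈ HF 𝒜 K ↔ B ≠ ⊥ ∧ (∃ t ∈ H 𝒜, algebraMap R K t • B ≤ 1) ∧ ComponentClosed 𝒜 B := by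
  constructor
  · rintro ⟨h0, t, ht, I, hI, htI⟩
    have ht0 : algebraMap R K t ≠ 0 := algebraMap_ne_zero_of_mem_H ht
    refine ⟨h0, ⟨t, ht, ?_⟩, fun r u hu hr α => ?_⟩
    · rw [htI]
      intro x hx
      obtain ⟨y, -, rfl⟩ := (IsLocalization.mem_coeSubmodule K I).1 hx
      exact algebraMap_mem_one y
    · have hu0 : algebraMap R K u ≠ 0 := algebraMap_ne_zero_of_mem_H hu
      have h1 := Submodule.smul_mem_pointwise_smul _ (algebraMap R K t) B hr
      rw [htI] at h1
      obtain ⟨b, hb, hbr⟩ := (IsLocalization.mem_coeSubmodule K I).1 h1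
      have h2 : t * r = u * b := by
        apply IsFractionRing.injective R K
        rw [map_mul, map_mul, hbr, smul_eq_mul]
        field_simp
      -- The element `t r = u b` lies in the homogeneous ideal `uI`, and its component of degree `τ
      -- + α` is `t r_α`. Hence `t r_α = u c` with `c ∈ I`.
      obtain ⟨τ, hτ⟩ := ht.1
      have h3 := isHomogeneous_span_mul hu hI (τ + α)
        (Ideal.mul_mem_mul (Ideal.mem_span_singleton_self u) hb)
      rw [← h2, DirectSum.coe_decompose_mul_add_of_left_mem 𝒜 hτ] at h3
      obtain ⟨c, hc, hce⟩ := Ideal.mem_span_singleton_mul.1 h3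
      have h4 : algebraMap R K t • (algebraMap R K (DirectSum.decompose 𝒜 r α : R) /
          algebraMap R K u) ∈ algebraMap R K t • B := by
        rw [htI]
        refine (IsLocalization.mem_coeSubmodule K I).2 ⟨c, hc, ?_⟩
        rw [smul_eq_mul, ← mul_div_assoc, ← map_mul, ← hce, map_mul]
        field_simp
      rw [mem_smul_iff ht0] at h4
      simpa [ht0] using h4
  · rintro ⟨h0, ⟨t, ht, htB⟩, hB⟩
    have ht0 : algebraMap R K t ≠ 0 := algebraMap_ne_zero_of_mem_H ht
    refine ⟨h0, t, ht, (algebraMap R K t • B).comap (Algebra.linearMap R K), ?_, ?_⟩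
    · intro α r hr
      have h1 : algebraMap R K r ∈ algebraMap R K t • B := hr
      rw [mem_smul_iff ht0, inv_mul_eq_div] at h1
      have h2 := hB r t ht h1 α
      change algebraMap R K _ ∈ algebraMap R K t • B
      rwa [mem_smul_iff ht0, inv_mul_eq_div]
    · rw [IsLocalization.coeSubmodule, Submodule.map_comap_eq, inf_eq_right.2]
      rwa [← Submodule.one_eq_range]

theorem HF_subset_F : HF 𝒜 K ⊆ F R K := by
  intro A hA
  obtain ⟨h0, ⟨t, ht, htA⟩, -⟩ := mem_HF_iff.1 hA
  refine ⟨h0, t, mem_nonZeroDivisors_of_ne_zero ht.2, fun x hx => ?_⟩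
  obtain ⟨r, hr⟩ := mem_one_iff.1 (htA (Submodule.smul_mem_pointwise_smul x _ A hx))
  exact ⟨r, by rw [hr, smul_eq_mul, Algebra.smul_def]⟩

theorem exists_of_mem_HF {A : Submodule R K} (hA : A ∈ HF 𝒜 K) {x : K} (hx : x ∈ A) :
    x ∈ RH 𝒜 K := by
  obtain ⟨-, ⟨t, ht, htA⟩, -⟩ := mem_HF_iff.1 hA
  obtain ⟨r, hr⟩ := mem_one_iff.1 (htA (Submodule.smul_mem_pointwise_smul x _ A hx))
  refine ⟨r, t, ht, ?_⟩
  rw [hr, smul_eq_mul, mul_div_cancel_left₀ _ (algebraMap_ne_zero_of_mem_H ht)]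

theorem mem_HF_of_le {A B : Submodule R K} (hA : A ∈ HF 𝒜 K) (hBA : B ≤ A) (hB0 : B ≠ ⊥)
    (hB : ComponentClosed 𝒜 B) : B ∈ HF 𝒜 K := by
  obtain ⟨-, ⟨t, ht, htA⟩, -⟩ := mem_HF_iff.1 hA
  exact mem_HF_iff.2 ⟨hB0, ⟨t, ht, (smul_le_smul _ hBA).trans htA⟩, hB⟩

theorem componentClosed_of_mem_HF {A : Submodule R K} (hA : A ∈ HF 𝒜 K) : ComponentClosed 𝒜 A :=
  (mem_HF_iff.1 hA).2.2

theorem ComponentClosed.inf {A B : Submodule R K} (hA : ComponentClosed 𝒜 A)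
    (hB : ComponentClosed 𝒜 B) : ComponentClosed 𝒜 (A ⊓ B) :=
  fun r t ht hr α => ⟨hA r t ht hr.1 α, hB r t ht hr.2 α⟩

theorem IsHomogeneousUnit.ne_zero {x : K} (hx : IsHomogeneousUnit 𝒜 x) : x ≠ 0 := by
  obtain ⟨a, ha, t, ht, rfl⟩ := hx
  exact div_ne_zero (algebraMap_ne_zero_of_mem_H ha) (algebraMap_ne_zero_of_mem_H ht)

theorem IsHomogeneousUnit.inv {x : K} (hx : IsHomogeneousUnit 𝒜 x) : IsHomogeneousUnit 𝒜 x⁻¹ := by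
  obtain ⟨a, ha, t, ht, rfl⟩ := hx
  exact ⟨t, ht, a, ha, by rw [inv_div]⟩

theorem isHomogeneousUnit_algebraMap {t : R} (ht : t ∈ H 𝒜) :
    IsHomogeneousUnit 𝒜 (algebraMap R K t) :=
  ⟨t, ht, 1, one_mem_H, by simp⟩

theorem exists_homogeneousUnit_mem {A : Submodule R K} (hA : A ∈ HF 𝒜 K) :
    ∃ x ∈ A, IsHomogeneousUnit 𝒜 x := by
  by_contra! hc
  exact hA.1 (le_bot_iff.1 (le_of_forall_homogeneousUnit hA fun x hx hxu => (hc x hx hxu).elim))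

theorem inf_mem_HF {A B : Submodule R K} (hA : A ∈ HF 𝒜 K) (hB : B ∈ HF 𝒜 K) :
    A ⊓ B ∈ HF 𝒜 K := by
  refine mem_HF_of_le hA inf_le_left ?_
    ((componentClosed_of_mem_HF hA).inf (componentClosed_of_mem_HF hB))
  obtain ⟨_, hx, a, ha, t, ht, rfl⟩ := exists_homogeneousUnit_mem hA
  obtain ⟨_, hy, b, hb, u, hu, rfl⟩ := exists_homogeneousUnit_mem hB
  -- Multiplying `a / t ∈ A` by `t b` and `b / u ∈ B` by `u a` gives the common element `a b`.
  refine (Submodule.ne_bot_iff _).2 ⟨algebraMap R K (a * b), ⟨?_, ?_⟩,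
    algebraMap_ne_zero_of_mem_H (mul_mem_H ha hb)⟩
  · have h := A.smul_mem (t * b) hx
    have := algebraMap_ne_zero_of_mem_H (K := K) ht
    rw [Algebra.smul_def, map_mul] at h
    rw [SetLike.mem_coe, map_mul]
    field_simp at h
    rwa [mul_comm]
  · have h := B.smul_mem (u * a) hy
    have := algebraMap_ne_zero_of_mem_H (K := K) hu
    rw [Algebra.smul_def, map_mul] at h
    rw [SetLike.mem_coe, map_mul]
    field_simp at h
    exact h

theorem smul_le_of_forall_homogeneousUnit {I A : Submodule R K} (hI : I ∈ HF 𝒜 K) {x : K}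
    (h : ∀ y ∈ I, IsHomogeneousUnit 𝒜 y → x * y ∈ A) : x • I ≤ A :=
  smul_le_iff.2 <|
    le_of_forall_homogeneousUnit (N := A.comap (LinearMap.mulLeft R x)) hI h

/-- The inclusion can be tested on homogeneous `y ∈ I`. Multiplication by such a `y` only shifts
degrees, so it carries the components of `r / t` to those of the product. -/
theorem ComponentClosed.smul_component_le {A I : Submodule R K} (hA : ComponentClosed 𝒜 A)
    (hI : I ∈ HF 𝒜 K) {r t : R} (ht : t ∈ H 𝒜)
    (h : (algebraMap R K r / algebraMap R K t) • I ≤ A) (α : Γ) :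
    (algebraMap R K (DirectSum.decompose 𝒜 r α : R) / algebraMap R K t) • I ≤ A := by
  refine smul_le_of_forall_homogeneousUnit hI ?_
  rintro _ hy ⟨a, ha, u, hu, rfl⟩
  have h1 := smul_le_iff.1 h _ hy
  obtain ⟨β, hβ⟩ := ha.1
  rw [div_mul_div_comm, ← map_mul, ← map_mul] at h1 ⊢
  have h2 := hA _ _ (mul_mem_H ht hu) h1 (α + β)
  rwa [DirectSum.coe_decompose_mul_add_of_right_mem 𝒜 hβ] at h2

theorem mem_RH_of_smul_le {A I : Submodule R K} (hA : A ∈ HF 𝒜 K) (hI : I ∈ HF 𝒜 K) {x : K}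
    (h : x • I ≤ A) : x ∈ RH 𝒜 K := by
  obtain ⟨_, hy, a, ha, u, hu, rfl⟩ := exists_homogeneousUnit_mem hI
  obtain ⟨r, t, ht, hr⟩ := exists_of_mem_HF hA (smul_le_iff.1 h _ hy)
  refine ⟨r * u, t * a, mul_mem_H ht ha, ?_⟩
  have := algebraMap_ne_zero_of_mem_H (K := K) ha
  have := algebraMap_ne_zero_of_mem_H (K := K) hu
  have := algebraMap_ne_zero_of_mem_H (K := K) ht
  rw [map_mul, map_mul]
  field_simp at hr ⊢
  linear_combination hr

/-! ### Operations on homogeneous star operations -/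

variable {s s' : Submodule R K → Submodule R K}

/-- The bounds `A ≤ s' A ≤ s A` supply the common denominator of `s' A` and squeeze the principal
case. The reverse inclusion for dilations is the given one for `x⁻¹`, and the remaining inclusions
need only be tested on homogeneous elements. -/
theorem IsHomStar.of_le (hs : IsHomStar 𝒜 s) (hs' : ∀ A ∈ HF 𝒜 K, s' A ≤ s A)
    (hcc : ∀ A ∈ HF 𝒜 K, ComponentClosed 𝒜 (s' A))
    (hle : ∀ A ∈ HF 𝒜 K, ∀ x ∈ A, IsHomogeneousUnit 𝒜 x → x ∈ s' A)
    (hmono : ∀ A ∈ HF 𝒜 K, ∀ B ∈ HF 𝒜 K, A ≤ B → s' A ≤ s' B)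
    (hsmul : ∀ x : K, IsHomogeneousUnit 𝒜 x → ∀ A ∈ HF 𝒜 K, x • s' A ≤ s' (x • A))
    (hidem : ∀ A ∈ HF 𝒜 K, s' A ∈ HF 𝒜 K →
      ∀ x ∈ s' (s' A), IsHomogeneousUnit 𝒜 x → x ∈ s' A) : IsHomStar 𝒜 s' := by
  have hle' : ∀ A ∈ HF 𝒜 K, A ≤ s' A := fun A hA => le_of_forall_homogeneousUnit hA (hle A hA)
  have hmem : ∀ A ∈ HF 𝒜 K, s' A ∈ HF 𝒜 K := fun A hA =>
    mem_HF_of_le (hs.mem A hA) (hs' A hA) (fun h => hA.1 (le_bot_iff.1 (h ▸ hle' A hA)))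
      (hcc A hA)
  refine ⟨hmem, fun x hx => ?_, fun x hx A hA => ?_, hle', hmono, fun A hA => ?_⟩
  · exact le_antisymm ((hs' _ (smul_mem_HF hx one_mem_HF)).trans (hs.principal x hx).le)
      (hle' _ (smul_mem_HF hx one_mem_HF))
  · refine le_antisymm ?_ (hsmul x hx A hA)
    have := hsmul x⁻¹ hx.inv _ (smul_mem_HF hx hA)
    rwa [inv_smul_smul₀ hx.ne_zero, smul_le_iff_le_inv_smul (inv_ne_zero hx.ne_zero),
      inv_inv] at this
  · exact le_antisymm
      (le_of_forall_homogeneousUnit (hmem _ (hmem A hA)) (hidem A hA (hmem A hA)))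
      (hle' _ (hmem A hA))

theorem IsHomStar.congr (hs : IsHomStar 𝒜 s) (h : Set.EqOn s' s (HF 𝒜 K)) : IsHomStar 𝒜 s' := by
  refine ⟨fun A hA => h hA ▸ hs.mem A hA, fun x hx => ?_, fun x hx A hA => ?_, fun A hA => ?_,
    fun A hA B hB hAB => ?_, fun A hA => ?_⟩
  · rw [h (smul_mem_HF hx one_mem_HF), hs.principal x hx]
  · rw [h (smul_mem_HF hx hA), h hA, hs.smul x hx A hA]
  · rw [h hA]
    exact hs.le A hA
  · rw [h hA, h hB]
    exact hs.mono A hA B hB hAB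
  · rw [h hA, h (hs.mem A hA), hs.idem A hA]

theorem IsHomStar.eq_one_of_le (hs : IsHomStar 𝒜 s) {I L : Submodule R K} (hI : I ∈ HF 𝒜 K)
    (hsI : s I = 1) (hL : L ∈ HF 𝒜 K) (hL1 : L ≤ 1) (hIL : I ≤ s L) : s L = 1 := by
  apply le_antisymm
  · rw [← hs.map_one]
    exact hs.mono L hL 1 one_mem_HF hL1
  · rw [← hsI, ← hs.idem L hL]
    exact hs.mono I hI _ (hs.mem L hL) hIL

theorem mem_homBar (hs : IsHomStar 𝒜 s) {A : Submodule R K} {x : K} :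
    x ∈ homBar 𝒜 s A ↔ ∃ I ∈ HF 𝒜 K, I ≤ 1 ∧ s I = 1 ∧ x • I ≤ A := by
  rw [← SetLike.mem_coe, coe_homBar hs]
  simp only [Set.mem_ofPred_eq, mem_div_iff]

theorem mem_homFiniteType (hs : IsHomStar 𝒜 s) {A : Submodule R K} (hA : A ∈ HF 𝒜 K) {x : K} :
    x ∈ homFiniteType 𝒜 s A ↔ ∃ B ∈ HF 𝒜 K, B.FG ∧ B ≤ A ∧ x ∈ s B := by
  rw [← SetLike.mem_coe, coe_homFiniteType hs hA, Set.mem_ofPred_eq]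

theorem componentClosed_homBar (hs : IsHomStar 𝒜 s) {A : Submodule R K} (hA : A ∈ HF 𝒜 K) :
    ComponentClosed 𝒜 (homBar 𝒜 s A) := by
  intro r t ht hr α
  obtain ⟨I, hI, hI1, hsI, hx⟩ := (mem_homBar hs).1 hr
  exact (mem_homBar hs).2
    ⟨I, hI, hI1, hsI, (componentClosed_of_mem_HF hA).smul_component_le hI ht hx α⟩

theorem mem_of_smul_le (hs : IsHomStar 𝒜 s) {A I : Submodule R K} (hA : A ∈ HF 𝒜 K)
    (hI : I ∈ HF 𝒜 K) (hsI : s I = 1) {x : K} (hx : IsHomogeneousUnit 𝒜 x) (h : x • I ≤ A) :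
    x ∈ s A := by
  have := hs.mono _ (smul_mem_HF hx hI) _ hA h
  rw [hs.smul x hx I hI, hsI] at this
  exact this mem_smul_one

/-- Applying `s` to `xI ⊆ A` is permitted only for homogeneous `x`, so `x` is first split into
components, each of which still multiplies `I` into `A`. -/
theorem homBar_le (hs : IsHomStar 𝒜 s) {A : Submodule R K} (hA : A ∈ HF 𝒜 K) :
    homBar 𝒜 s A ≤ s A := by
  intro x hx
  obtain ⟨I, hI, hI1, hsI, hxI⟩ := (mem_homBar hs).1 hx
  obtain ⟨r, t, ht, rfl⟩ := mem_RH_of_smul_le hA hI hxI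
  classical
  rw [← DirectSum.sum_support_decompose 𝒜 r, map_sum, Finset.sum_div]
  refine sum_mem fun i hi => mem_of_smul_le hs hA hI hsI ?_
    ((componentClosed_of_mem_HF hA).smul_component_le hI ht hxI i)
  exact ⟨_, ⟨⟨i, SetLike.coe_mem _⟩, by simpa using hi⟩, t, ht, rfl⟩

theorem IsHomStar.homBar (hs : IsHomStar 𝒜 s) : IsHomStar 𝒜 (homBar 𝒜 s) := by
  refine hs.of_le (fun A hA => homBar_le hs hA) (fun A hA => componentClosed_homBar hs hA)
    (fun A hA x hx _ => (mem_homBar hs).2 ⟨1, one_mem_HF, le_rfl, hs.map_one, smul_one_le hx⟩)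
    (fun A hA B hB hAB x hx => ?_) (fun x hx A hA => ?_) (fun A hA hA' x hx hxu => ?_)
  · obtain ⟨I, hI, hI1, hsI, hxI⟩ := (mem_homBar hs).1 hx
    exact (mem_homBar hs).2 ⟨I, hI, hI1, hsI, hxI.trans hAB⟩
  · rw [smul_le_iff]
    intro y hy
    obtain ⟨I, hI, hI1, hsI, hyI⟩ := (mem_homBar hs).1 hy
    refine (mem_homBar hs).2 ⟨I, hI, hI1, hsI, ?_⟩
    rw [← smul_smul]
    exact smul_le_smul x hyI
  · obtain ⟨I, hI, hI1, hsI, hxI⟩ := (mem_homBar hs).1 hx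
    -- `L = x⁻¹A ∩ R` is the largest ideal that `x` multiplies into `A`. Each homogeneous `y ∈ I`
    -- satisfies `yJ ⊆ L` for some `J` with `s J = 1`, hence `y ∈ s L`. So `I ⊆ s L` and `s L = 1`.
    have hL : x⁻¹ • A ⊓ 1 ∈ HF 𝒜 K := inf_mem_HF (smul_mem_HF hxu.inv hA) one_mem_HF
    refine (mem_homBar hs).2 ⟨x⁻¹ • A ⊓ 1, hL, inf_le_right, ?_, ?_⟩
    · refine hs.eq_one_of_le hI hsI hL inf_le_right (le_of_forall_homogeneousUnit hI ?_)
      intro y hy hyu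
      obtain ⟨J, hJ, hJ1, hsJ, hyJ⟩ := (mem_homBar hs).1 (smul_le_iff.1 hxI y hy)
      refine mem_of_smul_le hs hL hJ hsJ hyu (le_inf ?_ ?_)
      · rwa [← smul_le_iff_le_inv_smul hxu.ne_zero, smul_smul]
      · exact (smul_le_smul y hJ1).trans (smul_one_le (hI1 hy))
    · rw [smul_le_iff_le_inv_smul hxu.ne_zero]
      exact inf_le_left

theorem homFiniteType_le (hs : IsHomStar 𝒜 s) {A : Submodule R K} (hA : A ∈ HF 𝒜 K) :
    homFiniteType 𝒜 s A ≤ s A := by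
  intro x hx
  obtain ⟨B, hB, -, hBA, hxB⟩ := (mem_homFiniteType hs hA).1 hx
  exact hs.mono B hB A hA hBA hxB

theorem homFiniteType_eq (hs : IsHomStar 𝒜 s) {A : Submodule R K} (hA : A ∈ HF 𝒜 K)
    (hAf : A.FG) : homFiniteType 𝒜 s A = s A :=
  le_antisymm (homFiniteType_le hs hA) fun _ hx =>
    (mem_homFiniteType hs hA).2 ⟨A, hA, hAf, le_rfl, hx⟩

/-- Each of the finitely many generators of `B` has its own witness, and the witnesses can be added
up. This yields idempotence of `homFiniteType`. -/
theorem exists_fg_le_of_le_homFiniteType (hs : IsHomStar 𝒜 s) {A B : Submodule R K}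
    (hA : A ∈ HF 𝒜 K) (hBf : B.FG) (hBA : B ≤ homFiniteType 𝒜 s A) :
    ∃ C ∈ HF 𝒜 K, C.FG ∧ C ≤ A ∧ B ≤ s C := by
  classical
  obtain ⟨S, rfl⟩ := hBf
  rw [Submodule.span_le] at hBA
  simp only [Submodule.span_le]
  induction S using Finset.induction_on with
  | empty =>
    obtain ⟨x, hx, hxu⟩ := exists_homogeneousUnit_mem hA
    exact ⟨x • 1, smul_mem_HF hxu one_mem_HF, fg_smul fg_one x, smul_one_le hx, by simp⟩
  | insert x S _ ih =>
    rw [Finset.coe_insert, Set.insert_subset_iff] at hBA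
    obtain ⟨C, hC, hCf, hCA, hSC⟩ := ih hBA.2
    obtain ⟨D, hD, hDf, hDA, hxD⟩ := (mem_homFiniteType hs hA).1 hBA.1
    have hCD := sup_mem_HF hC hD
    refine ⟨C ⊔ D, hCD, hCf.sup hDf, sup_le hCA hDA, ?_⟩
    rw [Finset.coe_insert, Set.insert_subset_iff]
    exact ⟨hs.mono _ hD _ hCD le_sup_right hxD,
      hSC.trans (hs.mono _ hC _ hCD le_sup_left)⟩

theorem IsHomStar.homFiniteType (hs : IsHomStar 𝒜 s) :
    IsHomStar 𝒜 (homFiniteType 𝒜 s) := by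
  refine hs.of_le (fun A hA => homFiniteType_le hs hA) (fun A hA r t ht hr α => ?_)
    (fun A hA x hx hxu => (mem_homFiniteType hs hA).2 ⟨x • 1, smul_mem_HF hxu one_mem_HF,
      fg_smul fg_one x, smul_one_le hx, ?_⟩)
    (fun A hA B hB hAB x hx => ?_) (fun x hx A hA => ?_) (fun A hA hA' x hx hxu => ?_)
  · obtain ⟨B, hB, hBf, hBA, hx⟩ := (mem_homFiniteType hs hA).1 hr
    exact (mem_homFiniteType hs hA).2
      ⟨B, hB, hBf, hBA, componentClosed_of_mem_HF (hs.mem B hB) r t ht hx α⟩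
  · rw [hs.principal x hxu]
    exact mem_smul_one
  · obtain ⟨C, hC, hCf, hCA, hx⟩ := (mem_homFiniteType hs hA).1 hx
    exact (mem_homFiniteType hs hB).2 ⟨C, hC, hCf, hCA.trans hAB, hx⟩
  · rw [smul_le_iff]
    intro y hy
    obtain ⟨C, hC, hCf, hCA, hy⟩ := (mem_homFiniteType hs hA).1 hy
    refine (mem_homFiniteType hs (smul_mem_HF hx hA)).2
      ⟨x • C, smul_mem_HF hx hC, fg_smul hCf x, smul_le_smul x hCA, ?_⟩
    rw [hs.smul x hx C hC]
    exact Submodule.smul_mem_pointwise_smul y x _ hy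
  · obtain ⟨B, hB, hBf, hBA, hx⟩ := (mem_homFiniteType hs hA').1 hx
    obtain ⟨C, hC, hCf, hCA, hBC⟩ := exists_fg_le_of_le_homFiniteType hs hA hBf hBA
    refine (mem_homFiniteType hs hA).2 ⟨C, hC, hCf, hCA, ?_⟩
    rw [← hs.idem C hC]
    exact hs.mono B hB _ (hs.mem C hC) hBC hx

/-- If `I` has finite type closure `R`, then `1 ∈ s J` for some finitely generated `J ⊆ I`, and `J`
serves in place of `I`. Properties of `homTilde` thus reduce to those of the other two operations.
-/
theorem homTilde_eq (hs : IsHomStar 𝒜 s) {A : Submodule R K} (hA : A ∈ HF 𝒜 K) :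
    homTilde 𝒜 s A = homBar 𝒜 (homFiniteType 𝒜 s) A := by
  ext x
  rw [mem_homBar hs.homFiniteType, ← SetLike.mem_coe, coe_homTilde hs, Set.mem_ofPred_eq]
  constructor
  · rintro ⟨-, J, hJ, hJf, hJ1, hsJ, hx⟩
    exact ⟨J, hJ, hJ1, by rw [homFiniteType_eq hs hJ hJf, hsJ], hx⟩
  · rintro ⟨I, hI, hI1, hsI, hx⟩
    refine ⟨mem_RH_of_smul_le hA hI hx, ?_⟩
    have h1 : (1 : K) ∈ homFiniteType 𝒜 s I := hsI ▸ Submodule.one_le.1 le_rfl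
    obtain ⟨J, hJ, hJf, hJI, h1J⟩ := (mem_homFiniteType hs hI).1 h1
    refine ⟨J, hJ, hJf, hJI.trans hI1, ?_, (smul_le_smul x hJI).trans hx⟩
    refine hs.eq_one_of_le one_mem_HF hs.map_one hJ (hJI.trans hI1) (Submodule.one_le.2 h1J)

theorem IsHomStar.homTilde (hs : IsHomStar 𝒜 s) : IsHomStar 𝒜 (homTilde 𝒜 s) :=
  hs.homFiniteType.homBar.congr fun _ hA => homTilde_eq hs hA

theorem homTilde_le (hs : IsHomStar 𝒜 s) {A : Submodule R K} (hA : A ∈ HF 𝒜 K) :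
    homTilde 𝒜 s A ≤ s A := by
  rw [homTilde_eq hs hA]
  exact (homBar_le hs.homFiniteType hA).trans (homFiniteType_le hs hA)

end Graded

/-! ### Classical star operations as homogeneous star operations for the trivial grading -/

section Trivial

/-- The grading of a ring by the trivial monoid. -/
def trivialGrading (R : Type*) [CommRing R] : Unit → AddSubgroup R := fun _ => ⊤

instance (R : Type*) [CommRing R] : GradedRing (trivialGrading R) where
  one_mem := AddSubgroup.mem_top _
  mul_mem _ _ _ _ _ _ := AddSubgroup.mem_top _
  decompose' r := DirectSum.of (fun i => trivialGrading R i) () ⟨r, AddSubgroup.mem_top r⟩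
  left_inv r := by simp
  right_inv x := by
    induction x using DirectSum.induction_on with
    | zero => exact map_zero (DirectSum.of (fun i => trivialGrading R i) ())
    | of i x => simp
    | add x y hx hy =>
      conv_rhs => rw [← hx, ← hy]
      rw [← map_add, map_add]
      rfl

variable {R K : Type*} [CommRing R] [IsDomain R] [Field K] [Algebra R K] [IsFractionRing R K]

theorem mem_H_trivialGrading {t : R} : t ∈ H (trivialGrading R) ↔ t ≠ 0 :=
  ⟨fun h => h.2, fun h => ⟨⟨(), AddSubgroup.mem_top t⟩, h⟩⟩

theorem componentClosed_trivialGrading (B : Submodule R K) :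
    ComponentClosed (trivialGrading R) B := by
  intro r t _ hr α
  have : (DirectSum.decompose (trivialGrading R) r α : R) = r :=
    DirectSum.decompose_of_mem_same (trivialGrading R) (AddSubgroup.mem_top r)
  rwa [this]

/-- Every element is homogeneous for the trivial grading, so the component condition is void. The
facts proved for homogeneous star operations thereby specialize to classical ones. -/
theorem HF_trivialGrading : HF (trivialGrading R) K = F R K := by
  refine HF_subset_F.antisymm fun A hA => ?_
  obtain ⟨h0, t, ht, htA⟩ := hA
  refine mem_HF_iff.2 ⟨h0, ⟨t, mem_H_trivialGrading.2 (nonZeroDivisors.ne_zero ht), ?_⟩,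
    componentClosed_trivialGrading A⟩
  rw [smul_le_iff]
  intro y hy
  obtain ⟨r, hr⟩ := htA y hy
  exact mem_one_iff.2 ⟨r, by rw [hr, Algebra.smul_def]⟩

theorem isHomogeneousUnit_trivialGrading {x : K} :
    IsHomogeneousUnit (trivialGrading R) x ↔ x ≠ 0 := by
  refine ⟨fun h => h.ne_zero, fun h => ?_⟩
  obtain ⟨a, b, hb, rfl⟩ := IsFractionRing.div_surjective (A := R) x
  refine ⟨a, mem_H_trivialGrading.2 ?_, b,
    mem_H_trivialGrading.2 (nonZeroDivisors.ne_zero hb), rfl⟩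
  rintro rfl
  simp at h

variable {t t' : Submodule R K → Submodule R K}

theorem isHomStar_trivialGrading : IsHomStar (trivialGrading R) t ↔ IsStar t := by
  constructor
  · rintro ⟨h1, h2, h3, h4, h5, h6⟩
    simp only [HF_trivialGrading, isHomogeneousUnit_trivialGrading] at h1 h2 h3 h4 h5 h6
    exact ⟨h1, h2, h3, h4, h5, h6⟩
  · rintro ⟨h1, h2, h3, h4, h5, h6⟩
    constructor <;> simpa only [HF_trivialGrading, isHomogeneousUnit_trivialGrading]

theorem homBar_trivialGrading : homBar (trivialGrading R) t = bar t := by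
  funext A
  rw [homBar, HF_trivialGrading, bar]

theorem homFiniteType_trivialGrading : homFiniteType (trivialGrading R) t = finiteType t := by
  funext A
  rw [homFiniteType, HF_trivialGrading, finiteType]

theorem IsStar.bar (ht : IsStar t) : IsStar (bar t) := by
  rw [← isHomStar_trivialGrading, ← homBar_trivialGrading]
  exact (isHomStar_trivialGrading.2 ht).homBar

theorem IsStar.finiteType (ht : IsStar t) : IsStar (finiteType t) := by
  rw [← isHomStar_trivialGrading, ← homFiniteType_trivialGrading]
  exact (isHomStar_trivialGrading.2 ht).homFiniteType

theorem IsStar.map_one (ht : IsStar t) : t 1 = 1 := (isHomStar_trivialGrading.2 ht).map_one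

theorem finiteType_le (ht : IsStar t) {A : Submodule R K} (hA : A ∈ F R K) :
    finiteType t A ≤ t A := by
  rw [← homFiniteType_trivialGrading]
  exact homFiniteType_le (isHomStar_trivialGrading.2 ht) (by rwa [HF_trivialGrading])

theorem finiteType_eq (ht : IsStar t) {A : Submodule R K} (hA : A ∈ F R K) (hAf : A.FG) :
    finiteType t A = t A := by
  rw [← homFiniteType_trivialGrading]
  exact homFiniteType_eq (isHomStar_trivialGrading.2 ht) (by rwa [HF_trivialGrading]) hAf

theorem bar_le (ht : IsStar t) {A : Submodule R K} (hA : A ∈ F R K) : bar t A ≤ t A := by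
  rw [← homBar_trivialGrading]
  exact homBar_le (isHomStar_trivialGrading.2 ht) (by rwa [HF_trivialGrading])

theorem IsStar.eq_one_of_one_mem (ht : IsStar t) {I : Submodule R K} (hI : I ∈ F R K)
    (hI1 : I ≤ 1) (h : (1 : K) ∈ t I) : t I = 1 :=
  le_antisymm (ht.map_one ▸ ht.mono I hI 1 one_mem_F hI1) (Submodule.one_le.2 h)

theorem mem_finiteType (ht : IsStar t) {A : Submodule R K} (hA : A ∈ F R K) {x : K} :
    x ∈ finiteType t A ↔ ∃ B ∈ F R K, B.FG ∧ B ≤ A ∧ x ∈ t B := by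
  rw [← SetLike.mem_coe, coe_finiteType ht hA, Set.mem_ofPred_eq]

theorem mem_bar (ht : IsStar t) {A : Submodule R K} {x : K} :
    x ∈ bar t A ↔ ∃ I ∈ F R K, I ≤ 1 ∧ t I = 1 ∧ x • I ≤ A := by
  rw [← SetLike.mem_coe, coe_bar ht]
  simp only [Set.mem_ofPred_eq, mem_div_iff]

theorem mem_tilde (ht : IsStar t) {A : Submodule R K} {x : K} :
    x ∈ tilde t A ↔ ∃ J ∈ F R K, J.FG ∧ J ≤ 1 ∧ t J = 1 ∧ x • J ≤ A := by
  rw [← SetLike.mem_coe, coe_tilde ht, Set.mem_ofPred_eq]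

theorem tilde_eq (ht : IsStar t) : tilde t = bar (finiteType t) := by
  ext A x
  rw [mem_bar ht.finiteType, mem_tilde ht]
  constructor
  · rintro ⟨J, hJ, hJf, hJ1, htJ, hx⟩
    exact ⟨J, hJ, hJ1, by rw [finiteType_eq ht hJ hJf, htJ], hx⟩
  · rintro ⟨I, hI, hI1, htI, hx⟩
    have h1 : (1 : K) ∈ finiteType t I := htI ▸ Submodule.one_le.1 le_rfl
    obtain ⟨J, hJ, hJf, hJI, h1J⟩ := (mem_finiteType ht hI).1 h1
    exact ⟨J, hJ, hJf, hJI.trans hI1, ht.eq_one_of_one_mem hJ (hJI.trans hI1) h1J,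
      (smul_le_smul x hJI).trans hx⟩

theorem smul_mem_F {x : K} (hx : x ≠ 0) {A : Submodule R K} (hA : A ∈ F R K) : x • A ∈ F R K := by
  rw [← HF_trivialGrading] at hA ⊢
  exact smul_mem_HF (isHomogeneousUnit_trivialGrading.2 hx) hA

theorem inf_mem_F {A B : Submodule R K} (hA : A ∈ F R K) (hB : B ∈ F R K) : A ⊓ B ∈ F R K := by
  rw [← HF_trivialGrading] at hA hB ⊢
  exact inf_mem_HF hA hB

theorem isStable_bar (ht : IsStar t) : IsStable (bar t) := by
  intro A hA B hB
  refine le_antisymm (le_inf (ht.bar.mono _ (inf_mem_F hA hB) _ hA inf_le_left)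
    (ht.bar.mono _ (inf_mem_F hA hB) _ hB inf_le_right)) ?_
  rintro x ⟨hxA, hxB⟩
  obtain ⟨I, hI, hI1, htI, hxI⟩ := (mem_bar ht).1 hxA
  obtain ⟨J, hJ, hJ1, htJ, hxJ⟩ := (mem_bar ht).1 hxB
  refine (mem_bar ht).2 ⟨I * J, mul_mem_F hI hJ, (mul_le_mul' hI1 hJ1).trans (by simp),
    ht.mul_eq_one hI hJ hI1 hJ1 htI htJ, le_inf ?_ ?_⟩
  · exact (smul_le_smul x ((mul_le_mul' le_rfl hJ1).trans (by simp))).trans hxI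
  · exact (smul_le_smul x ((mul_le_mul' hI1 le_rfl).trans (by simp))).trans hxJ

/-- For `0 ≠ x ∈ t A`, stability gives `t (x⁻¹A ∩ R) = x⁻¹ t(A) ∩ R`, which contains `1`. So the
ideal `x⁻¹A ∩ R` witnesses `x ∈ bar t A`. -/
theorem IsStable.le_bar (h : IsStable t) (ht : IsStar t) {A : Submodule R K} (hA : A ∈ F R K) :
    t A ≤ bar t A := by
  intro x hx
  rcases eq_or_ne x 0 with rfl | hx0
  · exact zero_mem _
  have hxA := smul_mem_F (inv_ne_zero hx0) hA
  refine (mem_bar ht).2 ⟨x⁻¹ • A ⊓ 1, inf_mem_F hxA one_mem_F, inf_le_right, ?_, ?_⟩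
  · refine ht.eq_one_of_one_mem (inf_mem_F hxA one_mem_F) inf_le_right ?_
    rw [h _ hxA _ one_mem_F, ht.smul _ (inv_ne_zero hx0) _ hA, ht.map_one]
    refine ⟨?_, Submodule.one_le.1 le_rfl⟩
    rw [SetLike.mem_coe, mem_smul_iff (inv_ne_zero hx0)]
    simpa using hx
  · rw [smul_le_iff_le_inv_smul hx0]
    exact inf_le_left

theorem isFiniteType_finiteType (ht : IsStar t) : IsFiniteType (finiteType t) := by
  intro A hA
  refine le_antisymm (fun x hx => ?_) (finiteType_le ht.finiteType hA)
  obtain ⟨B, hB, hBf, hBA, hx⟩ := (mem_finiteType ht hA).1 hx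
  exact (mem_finiteType ht.finiteType hA).2
    ⟨B, hB, hBf, hBA, by rwa [finiteType_eq ht hB hBf]⟩

theorem IsStar.tilde (ht : IsStar t) : IsStar (tilde t) := tilde_eq ht ▸ ht.finiteType.bar

theorem isStable_tilde (ht : IsStar t) : IsStable (tilde t) :=
  tilde_eq ht ▸ isStable_bar ht.finiteType

theorem isFiniteType_tilde (ht : IsStar t) : IsFiniteType (tilde t) := by
  intro A hA
  refine le_antisymm (fun x hx => ?_) (finiteType_le ht.tilde hA)
  rcases eq_or_ne x 0 with rfl | hx0
  · exact zero_mem _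
  obtain ⟨J, hJ, hJf, hJ1, htJ, hxJ⟩ := (mem_tilde ht).1 hx
  -- `xJ` is finitely generated and inside `A`, and `J` itself shows that `x` is in its closure.
  exact (mem_finiteType ht.tilde hA).2 ⟨x • J, smul_mem_F hx0 hJ, fg_smul hJf x, hxJ,
    (mem_tilde ht).2 ⟨J, hJ, hJf, hJ1, htJ, le_rfl⟩⟩

theorem finiteType_mono (ht : IsStar t) (ht' : IsStar t') (h : ∀ A ∈ F R K, t A ≤ t' A) :
    ∀ A ∈ F R K, finiteType t A ≤ finiteType t' A := by
  intro A hA x hx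
  obtain ⟨B, hB, hBf, hBA, hx⟩ := (mem_finiteType ht hA).1 hx
  exact (mem_finiteType ht' hA).2 ⟨B, hB, hBf, hBA, h B hB hx⟩

theorem bar_mono (ht : IsStar t) (ht' : IsStar t') (h : ∀ A ∈ F R K, t A ≤ t' A) :
    ∀ A ∈ F R K, bar t A ≤ bar t' A := by
  intro A hA x hx
  obtain ⟨I, hI, hI1, htI, hx⟩ := (mem_bar ht).1 hx
  exact (mem_bar ht').2 ⟨I, hI, hI1,
    ht'.eq_one_of_one_mem hI hI1 (h I hI (htI ▸ Submodule.one_le.1 le_rfl)), hx⟩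

theorem tilde_mono (ht : IsStar t) (ht' : IsStar t') (h : ∀ A ∈ F R K, t A ≤ t' A) :
    ∀ A ∈ F R K, tilde t A ≤ tilde t' A := by
  rw [tilde_eq ht, tilde_eq ht']
  exact bar_mono ht.finiteType ht'.finiteType (finiteType_mono ht ht' h)

theorem IsStable.le_tilde (h : IsStable t) (hf : IsFiniteType t) (ht : IsStar t)
    {A : Submodule R K} (hA : A ∈ F R K) : t A ≤ tilde t A := by
  rw [tilde_eq ht]
  exact (h.le_bar ht hA).trans (bar_mono ht ht.finiteType (fun B hB => (hf hB).le) A hA)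

end Trivial

/-! ### The content and the extension `e` -/

section Graded

variable {Γ R : Type*} [AddCancelCommMonoid Γ] [DecidableEq Γ] [CommRing R] [IsDomain R]
variable {𝒜 : Γ → AddSubgroup R} [GradedRing 𝒜]
variable {K : Type*} [Field K] [Algebra R K] [IsFractionRing R K]

theorem contentIdeal_le {A B : Submodule R K} (hB : ComponentClosed 𝒜 B) (hAB : A ≤ B) :
    contentIdeal 𝒜 A ≤ B := by
  refine iSup₂_le fun f hf => Submodule.span_le.2 ?_
  rintro _ ⟨a, t, ht, α, rfl, rfl⟩
  exact hB a t ht (hAB hf) α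

theorem component_mem_contentIdeal {A : Submodule R K} {a : R} (ha : algebraMap R K a ∈ A)
    (α : Γ) : algebraMap R K (DirectSum.decompose 𝒜 a α : R) ∈ contentIdeal 𝒜 A :=
  (le_iSup₂ (f := fun f (_ : f ∈ A) => content 𝒜 f) _ ha)
    (Submodule.subset_span ⟨a, 1, one_mem_H, α, by simp, by simp⟩)

theorem le_contentIdeal {A : Submodule R K} (hA : A ≤ 1) : A ≤ contentIdeal 𝒜 A := by
  classical
  intro x hx
  obtain ⟨a, rfl⟩ := mem_one_iff.1 (hA hx)
  rw [← DirectSum.sum_support_decompose 𝒜 a, map_sum]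
  exact sum_mem fun i _ => component_mem_contentIdeal hx i

theorem contentIdeal_mono {A B : Submodule R K} (h : A ≤ B) :
    contentIdeal 𝒜 A ≤ contentIdeal 𝒜 B :=
  biSup_mono fun _ hx => h hx

theorem isHomogeneous_span_components (S : Set R) :
    (Ideal.span {r | ∃ a ∈ S, ∃ α, r = (DirectSum.decompose 𝒜 a α : R)}).IsHomogeneous 𝒜 :=
  Ideal.homogeneous_span 𝒜 _ (by rintro _ ⟨a, -, α, rfl⟩; exact ⟨α, SetLike.coe_mem _⟩)

theorem componentClosed_coeSubmodule {I : Ideal R} (hI : I.IsHomogeneous 𝒜) :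
    ComponentClosed 𝒜 (IsLocalization.coeSubmodule K I) := by
  rcases eq_or_ne (IsLocalization.coeSubmodule K I) ⊥ with h | h
  · rw [h]
    intro r t ht hr α
    rw [Submodule.mem_bot, div_eq_zero_iff, or_iff_left (algebraMap_ne_zero_of_mem_H ht),
      map_eq_zero_iff _ (IsFractionRing.injective R K)] at hr
    simp [hr]
  · exact componentClosed_of_mem_HF ⟨h, 1, one_mem_H, I, hI, by simp⟩

/-- The components of the generators already span a homogeneous ideal, which contains the whole
ideal. Homogeneity and finite generation of contents are read off from this. -/
theorem contentIdeal_coeSubmodule_span (S : Set R) :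
    contentIdeal 𝒜 (IsLocalization.coeSubmodule K (Ideal.span S)) =
      IsLocalization.coeSubmodule K
        (Ideal.span {r | ∃ a ∈ S, ∃ α, r = (DirectSum.decompose 𝒜 a α : R)}) := by
  classical
  apply le_antisymm
  · refine contentIdeal_le (componentClosed_coeSubmodule (isHomogeneous_span_components S)) ?_
    refine IsLocalization.coeSubmodule_mono K (Ideal.span_le.2 fun a ha => ?_)
    rw [← DirectSum.sum_support_decompose 𝒜 a]
    exact sum_mem fun i _ => Ideal.subset_span ⟨a, ha, i, rfl⟩
  · rw [IsLocalization.coeSubmodule_span, Submodule.span_le]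
    rintro _ ⟨_, ⟨a, ha, α, rfl⟩, rfl⟩
    exact component_mem_contentIdeal
      ((IsLocalization.mem_coeSubmodule K _).2 ⟨a, Ideal.subset_span ha, rfl⟩) α

theorem exists_coeSubmodule_eq {A : Submodule R K} (hA : A ≤ 1) :
    ∃ I : Ideal R, A = IsLocalization.coeSubmodule K I := by
  refine ⟨A.comap (Algebra.linearMap R K), ?_⟩
  rw [IsLocalization.coeSubmodule, Submodule.map_comap_eq, inf_eq_right.2]
  rwa [← Submodule.one_eq_range]

theorem contentIdeal_mem_HF {A : Submodule R K} (hA0 : A ≠ ⊥) (hA : A ≤ 1) :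
    contentIdeal 𝒜 A ∈ HF 𝒜 K := by
  refine mem_HF_of_le one_mem_HF
    (contentIdeal_le (componentClosed_of_mem_HF one_mem_HF) hA)
    (fun h => hA0 (le_bot_iff.1 (h ▸ le_contentIdeal hA))) ?_
  obtain ⟨I, rfl⟩ := exists_coeSubmodule_eq hA
  rw [← Ideal.span_eq I, contentIdeal_coeSubmodule_span]
  exact componentClosed_coeSubmodule (isHomogeneous_span_components _)

theorem contentIdeal_le_one {A : Submodule R K} (hA : A ≤ 1) : contentIdeal 𝒜 A ≤ 1 :=
  contentIdeal_le (componentClosed_of_mem_HF one_mem_HF) hA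

theorem contentIdeal_fg {A : Submodule R K} (hA : A ≤ 1) (hAf : A.FG) :
    (contentIdeal 𝒜 A).FG := by
  classical
  obtain ⟨I, rfl⟩ := exists_coeSubmodule_eq hA
  obtain ⟨S, rfl⟩ := Submodule.fg_of_fg_map_injective _ (IsFractionRing.injective R K) hAf
  rw [← Ideal.span, contentIdeal_coeSubmodule_span]
  refine Submodule.FG.map _ (Submodule.fg_span ?_)
  -- The inserted `0` accounts for the degrees outside the support.
  refine (Set.Finite.biUnion S.finite_toSet fun a _ =>
    ((insert 0 ((DirectSum.decompose 𝒜 a).support.image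
      fun i => (DirectSum.decompose 𝒜 a i : R))).finite_toSet)).subset ?_
  rintro _ ⟨a, ha, α, rfl⟩
  refine Set.mem_biUnion ha ?_
  by_cases h : DirectSum.decompose 𝒜 a α = 0
  · simp [h]
  · rw [Finset.coe_insert, Finset.coe_image]
    exact Or.inr ⟨α, by simpa using h, rfl⟩

theorem contentIdeal_eq {A : Submodule R K} (hA : A ∈ HF 𝒜 K) (hA1 : A ≤ 1) :
    contentIdeal 𝒜 A = A :=
  le_antisymm (contentIdeal_le (componentClosed_of_mem_HF hA) le_rfl) (le_contentIdeal hA1)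

variable {s s' : Submodule R K → Submodule R K}

theorem mem_e {A : Submodule R K} {x : K} :
    x ∈ e 𝒜 s A ↔ ∀ z : K, z ≠ 0 → z • A ≤ 1 → z * x ∈ s (contentIdeal 𝒜 (z • A)) := by
  simp only [e, Submodule.mem_iInf, mem_div_iff, and_imp]
  refine forall_congr' fun z => forall_congr' fun hz => forall_congr' fun _ => ?_
  rw [mem_smul_iff (inv_ne_zero hz), inv_inv]

theorem contentIdeal_smul_mem_HF {A : Submodule R K} (hA : A ∈ F R K) {z : K} (hz : z ≠ 0)
    (hzA : z • A ≤ 1) : contentIdeal 𝒜 (z • A) ∈ HF 𝒜 K :=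
  contentIdeal_mem_HF (smul_ne_bot hz hA.1) hzA

theorem smul_e_le {A : Submodule R K} {z : K} (hz : z ≠ 0) (hzA : z • A ≤ 1) :
    z • e 𝒜 s A ≤ s (contentIdeal 𝒜 (z • A)) :=
  smul_le_iff.2 fun _ hx => mem_e.1 hx z hz hzA

theorem IsHomStar.le_one (hs : IsHomStar 𝒜 s) {I : Submodule R K} (hI : I ∈ HF 𝒜 K)
    (hI1 : I ≤ 1) : s I ≤ 1 :=
  hs.map_one ▸ hs.mono I hI 1 one_mem_HF hI1

theorem exists_smul_le_one {A : Submodule R K} (hA : A ∈ F R K) : ∃ z : K, z ≠ 0 ∧ z • A ≤ 1 := by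
  rw [← HF_trivialGrading] at hA
  obtain ⟨-, ⟨t, ht, htA⟩, -⟩ := mem_HF_iff.1 hA
  exact ⟨_, algebraMap_ne_zero_of_mem_H ht, htA⟩

theorem mem_F_of_smul_le_one {A : Submodule R K} (hA : A ≠ ⊥) {z : K} (hz : z ≠ 0)
    (hzA : z • A ≤ 1) : A ∈ F R K := by
  refine ⟨hA, isFractional_mono (smul_mem_F (inv_ne_zero hz) one_mem_F).2 ?_⟩
  rwa [← smul_le_iff_le_inv_smul hz]

theorem le_e_self (hs : IsHomStar 𝒜 s) {A : Submodule R K} (hA : A ∈ F R K) : A ≤ e 𝒜 s A :=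
  fun x hx => mem_e.2 fun z hz hzA => hs.le _ (contentIdeal_smul_mem_HF hA hz hzA)
    (le_contentIdeal hzA (Submodule.smul_mem_pointwise_smul x z A hx))

theorem e_mono (hs : IsHomStar 𝒜 s) {A B : Submodule R K} (hA : A ∈ F R K) (hB : B ∈ F R K)
    (hAB : A ≤ B) : e 𝒜 s A ≤ e 𝒜 s B := by
  intro x hx
  refine mem_e.2 fun z hz hzB => ?_
  have hzAB := smul_le_smul z hAB
  exact hs.mono _ (contentIdeal_smul_mem_HF hA hz (hzAB.trans hzB)) _ (contentIdeal_smul_mem_HF hB hz hzB)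
    (contentIdeal_mono hzAB) (mem_e.1 hx z hz (hzAB.trans hzB))

theorem smul_e_le_e_smul {A : Submodule R K} {x : K} (hx : x ≠ 0) :
    x • e 𝒜 s A ≤ e 𝒜 s (x • A) := by
  refine smul_le_iff.2 fun y hy => mem_e.2 fun z hz hzA => ?_
  rw [smul_smul] at hzA ⊢
  rw [← mul_assoc]
  exact mem_e.1 hy _ (mul_ne_zero hz hx) hzA

theorem isStar_e (hs : IsHomStar 𝒜 s) : IsStar (e 𝒜 s : Submodule R K → Submodule R K) := by
  have hone : ∀ {A : Submodule R K}, A ∈ F R K → ∀ {z : K}, z ≠ 0 → z • A ≤ 1 →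
      z • e 𝒜 s A ≤ 1 := fun hA z hz hzA =>
    (smul_e_le hz hzA).trans (hs.le_one (contentIdeal_smul_mem_HF hA hz hzA) (contentIdeal_le_one hzA))
  have hmem : ∀ A ∈ F R K, e 𝒜 s A ∈ F R K := by
    intro A hA
    obtain ⟨z, hz, hzA⟩ := exists_smul_le_one hA
    exact mem_F_of_smul_le_one (fun h => hA.1 (le_bot_iff.1 (h ▸ le_e_self hs hA))) hz
      (hone hA hz hzA)
  refine ⟨hmem, fun x hx => ?_, fun x hx A hA => ?_, fun A hA => le_e_self hs hA,
    fun A hA B hB hAB => e_mono hs hA hB hAB, fun A hA => ?_⟩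
  · have hxF := smul_mem_F (R := R) hx one_mem_F
    refine le_antisymm ?_ (le_e_self hs hxF)
    have h := hone hxF (inv_ne_zero hx) (by rw [inv_smul_smul₀ hx])
    rwa [smul_le_iff_le_inv_smul (inv_ne_zero hx), inv_inv] at h
  · refine le_antisymm ?_ (smul_e_le_e_smul hx)
    have h := smul_e_le_e_smul (𝒜 := 𝒜) (s := s) (A := x • A) (inv_ne_zero hx)
    rwa [inv_smul_smul₀ hx, smul_le_iff_le_inv_smul (inv_ne_zero hx), inv_inv] at h
  -- Since `z e(A) ⊆ s(C(zA))` and the right side is homogeneous, also `C(z e(A)) ⊆ s(C(zA))`;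
  -- idempotence of `s` finishes.
  · refine le_antisymm (fun x hx => mem_e.2 fun z hz hzA => ?_) (le_e_self hs (hmem A hA))
    have hC := contentIdeal_smul_mem_HF (𝒜 := 𝒜) hA hz hzA
    have hze := hone hA hz hzA
    have hC' := contentIdeal_smul_mem_HF (𝒜 := 𝒜) (hmem A hA) hz hze
    rw [← hs.idem _ hC]
    exact hs.mono _ hC' _ (hs.mem _ hC)
      (contentIdeal_le (componentClosed_of_mem_HF (hs.mem _ hC)) (smul_e_le hz hzA))
      (mem_e.1 hx z hz hze)

/-- Here `z` lies in `R_H`, and each of its components `z_i` satisfies `z_i A ⊆ C(zA)`. Being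
homogeneous, `z_i` commutes with `s`, and summing over `i` gives the claim. -/
theorem smul_le_contentIdeal_smul (hs : IsHomStar 𝒜 s) {A : Submodule R K} (hA : A ∈ HF 𝒜 K)
    {z : K} (hz : z ≠ 0) (hzA : z • A ≤ 1) : z • s A ≤ s (contentIdeal 𝒜 (z • A)) := by
  classical
  have hC := contentIdeal_smul_mem_HF (𝒜 := 𝒜) (HF_subset_F hA) hz hzA
  obtain ⟨r, t, ht, rfl⟩ := mem_RH_of_smul_le one_mem_HF hA hzA
  have hcomp : ∀ i, (algebraMap R K (DirectSum.decompose 𝒜 r i : R) / algebraMap R K t) • s A ≤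
      s (contentIdeal 𝒜 ((algebraMap R K r / algebraMap R K t) • A)) := by
    intro i
    by_cases hi : (DirectSum.decompose 𝒜 r i : R) = 0
    · simp [hi]
    have hu : IsHomogeneousUnit 𝒜
        (algebraMap R K (DirectSum.decompose 𝒜 r i : R) / algebraMap R K t) :=
      ⟨_, ⟨⟨i, SetLike.coe_mem _⟩, hi⟩, t, ht, rfl⟩
    rw [← hs.smul _ hu A hA]
    exact hs.mono _ (smul_mem_HF hu hA) _ hC ((componentClosed_of_mem_HF hC).smul_component_le hA ht
      (le_contentIdeal hzA) i)
  refine smul_le_iff.2 fun y hy => ?_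
  have hr : algebraMap R K r / algebraMap R K t * y = ∑ i ∈ (DirectSum.decompose 𝒜 r).support,
      algebraMap R K (DirectSum.decompose 𝒜 r i : R) / algebraMap R K t * y := by
    rw [← Finset.sum_mul, ← Finset.sum_div, ← map_sum, DirectSum.sum_support_decompose]
  rw [hr]
  exact sum_mem fun i _ => smul_le_iff.1 (hcomp i) y hy

theorem e_eq (hs : IsHomStar 𝒜 s) {A : Submodule R K} (hA : A ∈ HF 𝒜 K) : e 𝒜 s A = s A := by
  apply le_antisymm
  -- A single `z` suffices here: for a homogeneous denominator `t` of `A`, the ideal `tA` is its own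
  -- content, and `t⁻¹ s(tA) = s A`.
  · obtain ⟨-, ⟨t, ht, htA⟩, -⟩ := mem_HF_iff.1 hA
    have htu := isHomogeneousUnit_algebraMap (K := K) ht
    have h := smul_e_le (s := s) (𝒜 := 𝒜) htu.ne_zero htA
    rw [contentIdeal_eq (smul_mem_HF htu hA) htA, hs.smul _ htu A hA,
      smul_le_iff_le_inv_smul htu.ne_zero, inv_smul_smul₀ htu.ne_zero] at h
    exact h
  · exact fun x hx => mem_e.2 fun z hz hzA =>
      smul_le_iff.1 (smul_le_contentIdeal_smul hs hA hz hzA) x hx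

theorem isExtension_e (hs : IsHomStar 𝒜 s) : IsExtension 𝒜 (e 𝒜 s) s :=
  ⟨hs, isStar_e hs, fun _ hA => e_eq hs hA⟩

variable {t : Submodule R K → Submodule R K}

/-- An inequality on homogeneous ideals propagates to all fractional ideals because `zA ⊆ C(zA)`.
This is the maximality of `e s`. -/
theorem IsStar.le_e (ht : IsStar t) (h : ∀ A ∈ HF 𝒜 K, t A ≤ s A) :
    ∀ A ∈ F R K, t A ≤ e 𝒜 s A := by
  intro A hA x hx
  refine mem_e.2 fun z hz hzA => ?_
  have hC := contentIdeal_smul_mem_HF (𝒜 := 𝒜) hA hz hzA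
  apply h _ hC
  apply ht.mono _ (smul_mem_F hz hA) _ (HF_subset_F hC) (le_contentIdeal hzA)
  rw [ht.smul z hz A hA]
  exact Submodule.smul_mem_pointwise_smul x z _ hx

/-! ### Extensions of `homFiniteType`, `homBar` and `homTilde` -/

/-- A finitely generated fractional ideal inside a homogeneous one is contained in a finitely
generated homogeneous one. -/
theorem exists_fg_mem_HF {A B : Submodule R K} (hA : A ∈ HF 𝒜 K) (hB : B ∈ F R K) (hBf : B.FG)
    (hBA : B ≤ A) : ∃ C ∈ HF 𝒜 K, C.FG ∧ B ≤ C ∧ C ≤ A := by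
  obtain ⟨-, ⟨t, ht, htA⟩, -⟩ := mem_HF_iff.1 hA
  have htu := isHomogeneousUnit_algebraMap (K := K) ht
  have htBA := smul_le_smul (algebraMap R K t) hBA
  refine ⟨(algebraMap R K t)⁻¹ • contentIdeal 𝒜 (algebraMap R K t • B),
    smul_mem_HF htu.inv (contentIdeal_smul_mem_HF hB htu.ne_zero (htBA.trans htA)),
    fg_smul (contentIdeal_fg (htBA.trans htA) (fg_smul hBf _)) _, ?_, ?_⟩
  · rw [← smul_le_iff_le_inv_smul htu.ne_zero]
    exact le_contentIdeal (htBA.trans htA)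
  · rw [smul_le_iff_le_inv_smul (inv_ne_zero htu.ne_zero), inv_inv]
    exact contentIdeal_le (componentClosed_of_mem_HF (smul_mem_HF htu hA)) htBA

theorem IsExtension.finiteType (h : IsExtension 𝒜 t s) :
    IsExtension 𝒜 (finiteType t) (homFiniteType 𝒜 s) := by
  refine ⟨h.isHomStar.homFiniteType, h.isStar.finiteType, fun A hA => ?_⟩
  ext x
  rw [mem_finiteType h.isStar (HF_subset_F hA), mem_homFiniteType h.isHomStar hA]
  constructor
  · rintro ⟨B, hB, hBf, hBA, hx⟩
    obtain ⟨C, hC, hCf, hBC, hCA⟩ := exists_fg_mem_HF hA hB hBf hBA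
    exact ⟨C, hC, hCf, hCA, h.eqOn hC ▸ h.isStar.mono _ hB _ (HF_subset_F hC) hBC hx⟩
  · rintro ⟨B, hB, hBf, hBA, hx⟩
    exact ⟨B, HF_subset_F hB, hBf, hBA, (h.eqOn hB).symm ▸ hx⟩

/-- If `xI ⊆ B` with `B` closed under homogeneous components and every `c` with `c C(I) ⊆ B` is in
`B`, then `x ∈ B`. -/
theorem ComponentClosed.mem_of_smul_le [IsAddTorsionFree Γ] {B I : Submodule R K}
    (hB : ComponentClosed 𝒜 B) (hI1 : I ≤ 1)
    (hc : ∀ c : K, IsHomogeneousUnit 𝒜 c → c • contentIdeal 𝒜 I ≤ B → c ∈ B) {x : K}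
    (hx : x ∈ RH 𝒜 K) (hxI : x • I ≤ B) : x ∈ B := by
  obtain ⟨r, t, ht, rfl⟩ := hx
  obtain ⟨J, rfl⟩ := exists_coeSubmodule_eq hI1
  have ht0 : algebraMap R K t ≠ 0 := algebraMap_ne_zero_of_mem_H ht
  -- Clearing the denominator `t` of `x` replaces `B` by the ideal of all `a ∈ R` with `a / t ∈ B`,
  -- to which `mem_of_forall_mul_mem` applies with `G = J`.
  have hmem : ∀ a : R, a ∈ (algebraMap R K t • B).comap (Algebra.linearMap R K) ↔
      algebraMap R K a / algebraMap R K t ∈ B := fun a => by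
    rw [Submodule.mem_comap, Algebra.linearMap_apply, mem_smul_iff ht0, inv_mul_eq_div]
  rw [← hmem]
  refine mem_of_forall_mul_mem 𝒜 (G := J) ?_ ?_ ?_
  · intro α a ha
    exact (hmem _).2 (hB a t ht ((hmem a).1 ha) α)
  · intro c hch hcJ
    rw [hmem]
    rcases eq_or_ne c 0 with rfl | hc0
    · simp
    refine hc _ ⟨c, ⟨hch, hc0⟩, t, ht, rfl⟩ ?_
    rw [smul_le_iff_le_inv_smul (div_ne_zero (algebraMap_ne_zero_of_mem_H ⟨hch, hc0⟩) ht0)]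
    rw [← Ideal.span_eq J, contentIdeal_coeSubmodule_span, IsLocalization.coeSubmodule_span,
      Submodule.span_le]
    rintro _ ⟨_, ⟨a, ha, α, rfl⟩, rfl⟩
    rw [SetLike.mem_coe, mem_smul_iff
      (inv_ne_zero (div_ne_zero (algebraMap_ne_zero_of_mem_H ⟨hch, hc0⟩) ht0)), inv_inv,
      div_mul_eq_mul_div, ← map_mul]
    exact (hmem _).1 (hcJ a ha α)
  · intro g hg
    rw [hmem, map_mul, ← div_mul_eq_mul_div]
    exact smul_le_iff.1 hxI _ ((IsLocalization.mem_coeSubmodule K J).2 ⟨g, hg, rfl⟩)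

/-- If `t I = 1`, then the larger homogeneous ideal `C(I)` satisfies `s (C(I)) = 1`, so it is an
admissible witness for `homBar s`. -/
theorem IsExtension.bar [IsAddTorsionFree Γ] (h : IsExtension 𝒜 t s) :
    IsExtension 𝒜 (bar t) (homBar 𝒜 s) := by
  have hs := h.isHomStar
  refine ⟨hs.homBar, h.isStar.bar, fun A hA => le_antisymm (fun x hx => ?_) fun x hx => ?_⟩
  · have hxs := bar_le h.isStar (HF_subset_F hA) hx
    rw [h.eqOn hA] at hxs
    obtain ⟨I, hI, hI1, htI, hxI⟩ := (mem_bar h.isStar).1 hx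
    have hC := contentIdeal_mem_HF (𝒜 := 𝒜) hI.1 hI1
    have hsC : s (contentIdeal 𝒜 I) = 1 := by
      rw [← h.eqOn hC]
      refine h.isStar.eq_one_of_one_mem (HF_subset_F hC) (contentIdeal_le_one hI1) ?_
      exact h.isStar.mono _ hI _ (HF_subset_F hC) (le_contentIdeal hI1)
        (htI ▸ Submodule.one_le.1 le_rfl)
    -- The ambient `B` is `homBar 𝒜 s A`, not `A`: by idempotence it contains every `c` with `c C(I)
    -- ⊆ B`. That `x ∈ R_H` follows from `bar t A ≤ t A = s A`.
    refine (componentClosed_homBar hs hA).mem_of_smul_le hI1 (fun c _ hcI => ?_)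
      (exists_of_mem_HF (hs.mem A hA) hxs) (hxI.trans (hs.homBar.le A hA))
    rw [← hs.homBar.idem A hA]
    exact (mem_homBar hs).2 ⟨_, hC, contentIdeal_le_one hI1, hsC, hcI⟩
  · obtain ⟨I, hI, hI1, hsI, hxI⟩ := (mem_homBar hs).1 hx
    exact (mem_bar h.isStar).2 ⟨I, HF_subset_F hI, hI1, (h.eqOn hI).trans hsI, hxI⟩

theorem IsExtension.tilde [IsAddTorsionFree Γ] (h : IsExtension 𝒜 t s) :
    IsExtension 𝒜 (tilde t) (homTilde 𝒜 s) := by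
  have h' := h.finiteType.bar
  refine ⟨h.isHomStar.homTilde, h.isStar.tilde, fun A hA => ?_⟩
  rw [homTilde_eq h.isHomStar hA, tilde_eq h.isStar]
  exact h'.eqOn hA

/-! ### Maximality and the main theorem -/

/-- Largest extensions of `s' ≤ s` with the property `P`, from an operation `Φ` that turns every
star operation into one with the property `P`. -/
theorem isLargestExtension_of_mono {P : (Submodule R K → Submodule R K) → Prop}
    {Φ : (Submodule R K → Submodule R K) → Submodule R K → Submodule R K}
    (hΦ : ∀ {t t' : Submodule R K → Submodule R K}, IsStar t → IsStar t' →
      (∀ A ∈ F R K, t A ≤ t' A) → ∀ A ∈ F R K, Φ t A ≤ Φ t' A)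
    (hP : ∀ {t : Submodule R K → Submodule R K}, IsStar t → P t → ∀ A ∈ F R K, t A ≤ Φ t A)
    (hs : IsHomStar 𝒜 s) (hs' : ∀ A ∈ HF 𝒜 K, s' A ≤ s A)
    (hext : IsExtension 𝒜 (Φ (e 𝒜 s)) s') (hPe : P (Φ (e 𝒜 s))) :
    Set.EqOn (Φ (e 𝒜 s)) (Φ (e 𝒜 s')) (F R K) ∧ IsLargestExtension 𝒜 P (Φ (e 𝒜 s)) s' := by
  have he' := isStar_e hext.isHomStar
  have hle : ∀ t', IsExtension 𝒜 t' s' → P t' → ∀ A ∈ F R K, t' A ≤ Φ (e 𝒜 s') A :=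
    fun t' h' hP' A hA => (hP h'.isStar hP' A hA).trans
      (hΦ h'.isStar he' (h'.isStar.le_e fun B hB => (h'.eqOn hB).le) A hA)
  have hle' : ∀ A ∈ F R K, Φ (e 𝒜 s') A ≤ Φ (e 𝒜 s) A :=
    hΦ he' (isStar_e hs) (he'.le_e fun A hA => (e_eq hext.isHomStar hA).trans_le (hs' A hA))
  exact ⟨fun A hA => le_antisymm (hle _ hext hPe A hA) (hle' A hA), hext, hPe,
    fun t' h' hP' A hA => (hle t' h' hP' A hA).trans (hle' A hA)⟩

end Graded

end GradedStar

theorem mainTheorem3 {Γ R K : Type*} [AddCancelCommMonoid Γ] [IsAddTorsionFree Γ]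
    [DecidableEq Γ] [CommRing R] [IsDomain R] (𝒜 : Γ → AddSubgroup R) [GradedRing 𝒜]
    [Field K] [Algebra R K] [IsFractionRing R K]
    (s : Submodule R K → Submodule R K) (hs : GradedStar.IsHomStar 𝒜 s) :
    (Set.EqOn (GradedStar.finiteType (GradedStar.e 𝒜 s))
        (GradedStar.finiteType (GradedStar.e 𝒜 (GradedStar.homFiniteType 𝒜 s)))
        (GradedStar.F R K) ∧
      GradedStar.IsLargestExtension 𝒜 GradedStar.IsFiniteType
        (GradedStar.finiteType (GradedStar.e 𝒜 s)) (GradedStar.homFiniteType 𝒜 s)) ∧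
    (Set.EqOn (GradedStar.tilde (GradedStar.e 𝒜 s))
        (GradedStar.tilde (GradedStar.e 𝒜 (GradedStar.homTilde 𝒜 s)))
        (GradedStar.F R K) ∧
      GradedStar.IsLargestExtension 𝒜
        (fun t => GradedStar.IsStable t ∧ GradedStar.IsFiniteType t)
        (GradedStar.tilde (GradedStar.e 𝒜 s)) (GradedStar.homTilde 𝒜 s)) ∧
    (Set.EqOn (GradedStar.bar (GradedStar.e 𝒜 s))
        (GradedStar.bar (GradedStar.e 𝒜 (GradedStar.homBar 𝒜 s)))
        (GradedStar.F R K) ∧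
      GradedStar.IsLargestExtension 𝒜 GradedStar.IsStable
        (GradedStar.bar (GradedStar.e 𝒜 s)) (GradedStar.homBar 𝒜 s)) := by
  have h := GradedStar.isExtension_e hs
  have he := h.isStar
  refine ⟨?_, ?_, ?_⟩
  · exact GradedStar.isLargestExtension_of_mono (fun h h' => GradedStar.finiteType_mono h h')
      (fun _ hP A hA => (hP hA).le) hs (fun A hA => GradedStar.homFiniteType_le hs hA)
      h.finiteType (GradedStar.isFiniteType_finiteType he)
  · exact GradedStar.isLargestExtension_of_mono (fun h h' => GradedStar.tilde_mono h h')
      (fun ht hP A hA => hP.1.le_tilde hP.2 ht hA) hs (fun A hA => GradedStar.homTilde_le hs hA)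
      h.tilde ⟨GradedStar.isStable_tilde he, GradedStar.isFiniteType_tilde he⟩
  · exact GradedStar.isLargestExtension_of_mono (fun h h' => GradedStar.bar_mono h h')
      (fun ht hP A hA => hP.le_bar ht hA) hs (fun A hA => GradedStar.homBar_le hs hA)
      h.bar (GradedStar.isStable_bar he)
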